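/- Let $\lambda>0$ and $n\ge 1$, and let $N^1,\dots,N^n$ be independent Poisson processes of intensity $\lambda$ on a probability space $(\Omega,\mathcal F,P)$. Put $V^{(1)}_t=N^1_t$ and $V^{(m+1)}_t=N^{m+1}_{V^{(m)}_t}$ for $1\le m<n$, with the convention $V^{(0)}_t=t$. Let $(\mathcal F_t)_{t\ge0}$ be the natural filtration of $V^{(n)}$. Define $\ell_1(z)=\lambda(e^{z}-1)$ and $\ell_m(z)=\lambda e^{\ell_{m-1}(z)}-\lambda$ for $m\ge2$, $z\in\mathbb C$. Martingales are with respect to $(\mathcal F_t)$ and $P$. (a) $E V^{(n)}_t=\lambda^n t$ for all $t\ge 0$, and $M_t:=V^{(n)}_t-\lambda^n t$ is a martingale. (b) $\ell_n$ is the characteristic exponent of $V^{(n)}$: $E e^{zV^{(n)}_t}=e^{t\ell_n(z)}$ (absolutely convergent) for all $t\ge0$, $z\in\mathbb C$. For every $\theta\in\mathbb R$ the process $e^{\theta V^{(n)}_t-t\ell_n(\theta)}$ is a martingale. For $\theta\in\mathbb R$ and a horizon $T\ge0$ let $P^\theta_T$ be given by $dP^\theta_T/dP=e^{\theta V^{(n)}_T-T\ell_n(\theta)}$.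 Then $P^\theta_T$ is a probability measure equivalent to $P$, $P^\theta_T=P^\theta_s$ on $\mathcal F_s$ for $s\le T$, and under $P^\theta_T$ the process $(V^{(n)}_t)_{0\le t\le T}$ is a Lévy process with characteristic exponent $\ell_n^\theta(z)=\ell_n(z+\theta)-\ell_n(\theta)$, $z\in\mathbb C$. (c) $M_t^2-\frac{1-\lambda^n}{1-\lambda}\lambda^n t$ is a martingale, where $\frac{1-\lambda^n}{1-\lambda}$ is read as $n$ if $\lambda=1$. (d) There exist i.i.d. random variables $Y_1,Y_2,\dots$ on $\Omega$, independent of the process $N^1$, with $Y_i\overset{d}{=}V^{(n-1)}_1$; and for every such sequence the processes $(V^{(n)}_t)_{t\ge0}$ and $\big(\sum_{i=1}^{N^1_t}Y_i\big)_{t\ge0}$ have the same law. Under $P$ the process $V^{(n)}$ is a Lévy process whose Lévy measure $\nu_n$ (a measure on $\mathbb R$ without mass at $0$) is concentrated on the positive integers, with $\nu_n(\{k\})=\lambda P(V^{(n-1)}_1=k)$, $k\ge1$. For every $\theta\in\mathbb R$ and $T\ge 0$, the Lévy measure of $(V^{(n)}_t)_{0\le t\le T}$ under $P^\theta_T$ is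 concentrated on the positive integers, with mass $\nu^\theta_n(\{k\})=\lambda e^{k\theta}P(V^{(n-1)}_1=k)$ at each $k\ge1$. (e) $\lim_{t\to+\infty}V^{(n)}_t/t=\lambda^n$ almost surely. -/

import Mathlib

open MeasureTheory ProbabilityTheory Filter Topology
open scoped NNReal ENNReal

noncomputable section

namespace MIPP

/-- A (homogeneous) Poisson process with intensity `lam`, indexed by `[0, ∞)`: it starts at `0`,
has independent increments, `N t - N s` is Poisson distributed with parameter `lam * (t - s)`, and
almost all paths are nondecreasing and right-continuous. The paths are `ℕ`-valued, so left limits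
exist automatically. -/
structure IsPoissonProcess {Ω : Type*} [MeasurableSpace Ω] (N : ℝ≥0 → Ω → ℕ) (lam : ℝ≥0) (P : Measure Ω) : Prop where
  measurable : ∀ t, Measurable (N t)
  zero : ∀ᵐ ω ∂P, N 0 ω = 0
  indep : HasIndepIncrements (fun t ω => (N t ω : ℝ)) P
  law : ∀ s t : ℝ≥0, s ≤ t →
    P.map (fun ω => (N t ω : ℝ) - (N s ω : ℝ)) =
      (poissonMeasure (lam * (t - s))).map (fun k : ℕ => (k : ℝ))
  path : ∀ᵐ ω ∂P, Monotone (fun t => N t ω) ∧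
    ∀ t, ContinuousWithinAt (fun s => N s ω) (Set.Ici t) t

/-- The multiply iterated process built from `N 1, N 2, …`:
`V⁽¹⁾_t = N¹_t` and `V⁽ᵐ⁺¹⁾_t = Nᵐ⁺¹(V⁽ᵐ⁾_t)`, with the convention `V⁽⁰⁾_t = t`. -/
def mipp {Ω : Type*} (N : ℕ → ℝ≥0 → Ω → ℕ) : ℕ → ℝ≥0 → Ω → ℝ≥0
  | 0, t, _ => t
  | m + 1, t, ω => (N (m + 1) (mipp N m t ω) ω : ℝ≥0)

lemma countable_range_mipp {Ω : Type*} (N : ℕ → ℝ≥0 → Ω → ℕ) (m : ℕ) (t : ℝ≥0) :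
    (Set.range (mipp N m t)).Countable := by
  cases m with
  | zero => exact (Set.countable_singleton t).mono (by rintro _ ⟨ω, rfl⟩; rfl)
  | succ m =>
    refine (Set.countable_range (fun k : ℕ => (k : ℝ≥0))).mono ?_
    rintro _ ⟨ω, rfl⟩
    exact ⟨_, rfl⟩

lemma measurable_mipp {Ω : Type*} [MeasurableSpace Ω] {N : ℕ → ℝ≥0 → Ω → ℕ} {n : ℕ}
    (hN : ∀ i ∈ Finset.Icc 1 n, ∀ t, Measurable (N i t)) (t : ℝ≥0) :
    Measurable (mipp N n t) := by
  induction n with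
  | zero => exact measurable_const
  | succ m ih =>
    have ihm := ih fun i hi => hN i (by simp only [Finset.mem_Icc] at hi ⊢; omega)
    have hm := hN (m + 1) (by simp)
    have hc := countable_range_mipp N m t
    have key : Measurable (fun ω => N (m + 1) (mipp N m t ω) ω) := by
      intro A _
      have : (fun ω => N (m + 1) (mipp N m t ω) ω) ⁻¹' A =
          ⋃ x ∈ Set.range (mipp N m t), (mipp N m t ⁻¹' {x}) ∩ (N (m + 1) x ⁻¹' A) := by
        ext ω
        simp only [Set.mem_preimage, Set.mem_iUnion, Set.mem_inter_iff, Set.mem_singleton_iff]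
        constructor
        · intro h
          exact ⟨_, ⟨ω, rfl⟩, rfl, h⟩
        · rintro ⟨x, _, rfl, h⟩
          exact h
      rw [this]
      exact MeasurableSet.biUnion hc fun x _ =>
        (ihm (measurableSet_singleton x)).inter (hm x trivial)
    exact (measurable_from_nat (f := fun k : ℕ => (k : ℝ≥0))).comp key

/-- `V⁽ⁿ⁾` as a real-valued process. -/
def V {Ω : Type*} (N : ℕ → ℝ≥0 → Ω → ℕ) (n : ℕ) (t : ℝ≥0) (ω : Ω) : ℝ := mipp N n t ω

/-- The probability `P (V⁽ᵐ⁾_1 = k)`. -/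
def pmf {Ω : Type*} [MeasurableSpace Ω] (P : Measure Ω) (N : ℕ → ℝ≥0 → Ω → ℕ) (m k : ℕ) : ℝ :=
  P.real {ω | V N m 1 ω = k}

/-- The compensated process `M_t = V⁽ⁿ⁾_t - lam ^ n t`. -/
def M {Ω : Type*} (N : ℕ → ℝ≥0 → Ω → ℕ) (lam : ℝ≥0) (n : ℕ) (t : ℝ≥0) (ω : Ω) : ℝ :=
  V N n t ω - (lam : ℝ) ^ n * t

/-- The natural filtration of `V⁽ⁿ⁾`. -/
def mippFiltration {Ω : Type*} [mΩ : MeasurableSpace Ω] (N : ℕ → ℝ≥0 → Ω → ℕ) (n : ℕ)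
    (hN : ∀ i ∈ Finset.Icc 1 n, ∀ t, Measurable (N i t)) : Filtration ℝ≥0 mΩ :=
  Filtration.natural (mipp N n) fun t => (measurable_mipp hN t).stronglyMeasurable

/-- `ℓ_1(θ) = lam (e^θ - 1)`, `ℓ_{m+1}(θ) = lam e^{ℓ_m(θ)} - lam`, real argument
(with `ℓ_0(θ) = θ`, the exponent of `V⁽⁰⁾_t = t`). -/
def ell (lam : ℝ≥0) : ℕ → ℝ → ℝ
  | 0, θ => θ
  | m + 1, θ => lam * Real.exp (ell lam m θ) - lam

/-- The same recursion for a complex argument. -/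
def ellC (lam : ℝ≥0) : ℕ → ℂ → ℂ
  | 0, z => z
  | m + 1, z => (lam : ℝ) * Complex.exp (ellC lam m z) - (lam : ℝ)

/-- `(1 - lam ^ n) / (1 - lam)`, with its limiting value `n` at `lam = 1`. -/
def geomRatio (lam : ℝ) (n : ℕ) : ℝ :=
  if lam = 1 then n else (1 - lam ^ n) / (1 - lam)

/-- `P^θ` with horizon `T`: the measure with `dP^θ/dP = exp (θ V⁽ⁿ⁾_T - T ℓ_n(θ))`. -/
def tilt {Ω : Type*} [MeasurableSpace Ω]
    (P : Measure Ω) (N : ℕ → ℝ≥0 → Ω → ℕ) (lam : ℝ≥0) (n : ℕ) (θ : ℝ) (T : ℝ≥0) :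
    Measure Ω :=
  P.withDensity fun ω =>
    ENNReal.ofReal (Real.exp (θ * V N n T ω - (T : ℝ) * ell lam n θ))

/-- `X`, restricted to the times `t ≤ T`, is a real Lévy process under `Q`; `T = ∞` is allowed. -/
structure IsLevyProcess {Ω : Type*} [MeasurableSpace Ω]
    (T : ℝ≥0∞) (X : ℝ≥0 → Ω → ℝ) (Q : Measure Ω) : Prop where
  isProbabilityMeasure : IsProbabilityMeasure Q
  measurable : ∀ t : ℝ≥0, (t : ℝ≥0∞) ≤ T → Measurable (X t)
  zero : ∀ᵐ ω ∂Q, X 0 ω = 0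
  indep : HasIndepIncrements (fun (t : {t : ℝ≥0 // (t : ℝ≥0∞) ≤ T}) => X t) Q
  stationary : ∀ s h : ℝ≥0, ((s + h : ℝ≥0) : ℝ≥0∞) ≤ T →
    Q.map (fun ω => X (s + h) ω - X s ω) = Q.map (X h)
  cadlag : ∀ᵐ ω ∂Q, ∀ t : ℝ≥0, (t : ℝ≥0∞) ≤ T →
    ContinuousWithinAt (fun s => X s ω) {s | t ≤ s ∧ (s : ℝ≥0∞) ≤ T} t ∧
      ∃ l : ℝ, Tendsto (fun s => X s ω) (𝓝[<] t) (𝓝 l)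

/-- `X` has exponent `ψ` under `Q` on the times `t ≤ T`: `E_Q e^{z X_t} = e^{t ψ(z)}` for every
complex `z`, the expectation being absolutely convergent. -/
def HasExponent {Ω : Type*} [MeasurableSpace Ω]
    (T : ℝ≥0∞) (X : ℝ≥0 → Ω → ℝ) (Q : Measure Ω) (ψ : ℂ → ℂ) : Prop :=
  ∀ t : ℝ≥0, (t : ℝ≥0∞) ≤ T → ∀ z : ℂ,
    Integrable (fun ω => Complex.exp (z * (X t ω : ℂ))) Q ∧
      ∫ ω, Complex.exp (z * (X t ω : ℂ)) ∂Q = Complex.exp ((t : ℝ) * ψ z)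

/-- `X` is, on the times `t ≤ T`, a Lévy process under `Q` with Lévy measure `ν`
(Lévy–Khintchine formula with some drift `b` and Gaussian variance `a`). -/
def HasLevyMeasure {Ω : Type*} [MeasurableSpace Ω]
    (T : ℝ≥0∞) (X : ℝ≥0 → Ω → ℝ) (Q : Measure Ω) (ν : Measure ℝ) : Prop :=
  IsLevyProcess T X Q ∧ ν {0} = 0 ∧ ∫⁻ x, ENNReal.ofReal (min 1 (x ^ 2)) ∂ν < ∞ ∧
    ∃ b a : ℝ, 0 ≤ a ∧ ∀ t : ℝ≥0, (t : ℝ≥0∞) ≤ T → ∀ u : ℝ,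
      ∫ ω, Complex.exp (Complex.I * u * (X t ω : ℂ)) ∂Q =
        Complex.exp ((t : ℝ) * (Complex.I * b * u - a * u ^ 2 / 2 +
          ∫ x : ℝ, (Complex.exp (Complex.I * u * x) - 1 -
            (if |x| ≤ 1 then Complex.I * u * x else 0)) ∂ν))

/-- The measure on `ℝ` carried by the positive integers with mass `w k` at `k`. -/
def atomicMeasure (w : ℕ → ℝ) : Measure ℝ :=
  Measure.sum fun k : ℕ+ => ENNReal.ofReal (w k) • Measure.dirac (((k : ℕ) : ℝ))

/-- `Y 0, Y 1, …` are i.i.d., distributed as `V⁽ᵐ⁾_1`, and independent of the process `N¹`. -/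
structure IsJumpSequence {Ω : Type*} [MeasurableSpace Ω]
    (Y : ℕ → Ω → ℝ≥0) (N : ℕ → ℝ≥0 → Ω → ℕ) (m : ℕ) (P : Measure Ω) :
    Prop where
  measurable : ∀ i, Measurable (Y i)
  iIndep : iIndepFun Y P
  identDistrib : ∀ i, IdentDistrib (Y i) (mipp N m 1) P P
  indep_fst : IndepFun (fun ω i => Y i ω) (fun ω t => N 1 t ω) P

end MIPP

end

/-!
All parts rest on one formula, the joint exponent `MIPP.HasJointExponent`: for times
`u 0 ≤ u 1 ≤ …` and complex `z i`,
`E exp (∑ z i (V_{u (i+1)} - V_{u i})) = exp (∑ (u (i+1) - u i) ℓ_n (z i))`, with absolute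
convergence.

For a Poisson process it is the product of the Poisson moment generating functions
(`IsPoissonProcess.hasJointExponent`). The iteration is read from the inside,
`V⁽ᵐ⁺¹⁾_t = W (N¹_t)` with `W` the `m`-fold iteration of `N², N³, …`, which is independent of `N¹`
(`mipp_succ_eq_shift`, `indepFun_fst_shift`); conditioning on `N¹`, whose values at fixed times are
integers, composes the exponents (`HasJointExponent.comp`), so that induction gives the formula for
`V⁽ⁿ⁾` (`hasJointExponent_V`).

At imaginary arguments the formula is the joint characteristic function of the increments. Hence
the increments are independent and stationary, and monotonicity and right-continuity of the paths
pass through the composition, so `V⁽ⁿ⁾` is a Lévy process (`HasJointExponent.isLevyProcess`).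
Including the times `0` and `T` in the sequence turns the formula under `P` into the one under
`P^θ_T` (`HasJointExponent.esscher`), so the tilted process is covered by the same lemmas. At real
arguments the formula gives the moments of the increments, by differentiation at `0`, and the three
martingales, since an increment after time `s` is independent of the natural filtration at `s`
(`indepFun_increment_past`).

For the compound Poisson representation, the jumps are `Y i = W (i + 1) - W i`; the joint law of
`N¹` and any jump sequence is the same product measure (`IsJumpSequence.map_prod_eq`). The Lévy
measure is read off from `ℓ_{m+1} = lam e^{ℓ_m} - lam` by expanding `e^{ℓ_m(z)}` over the values of
`V⁽ᵐ⁾_1` (`hasLevyMeasure_atomic`). The law of large numbers is the classical one for the increments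
over `[i, i + 1]`, extended to real times by monotonicity.
-/

namespace MIPP

/-! ### Processes with a joint exponent -/

/-- `X` has *joint exponent* `ψ` under `Q` up to time `T`: for every nondecreasing sequence
`u 0 ≤ u 1 ≤ …` of times `≤ T` and all complex `z 0, z 1, …`,
`E_Q exp (∑_{i<k} z i (X_{u (i+1)} - X_{u i})) = exp (∑_{i<k} (u (i+1) - u i) ψ (z i))`,
the expectation being absolutely convergent. This packages independence and stationarity of the
increments together with their exponential moments. Sequences indexed by `ℕ` are used instead of
tuples, so that times can be added in front and at the end without casts between `Fin` types. -/
def HasJointExponent {Ω : Type*} [MeasurableSpace Ω] (T : ℝ≥0∞) (X : ℝ≥0 → Ω → ℝ) (Q : Measure Ω)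
    (ψ : ℂ → ℂ) : Prop :=
  ∀ (k : ℕ) (u : ℕ → ℝ≥0), Monotone u → (∀ i, (u i : ℝ≥0∞) ≤ T) → ∀ z : ℕ → ℂ,
    Integrable (fun ω => Complex.exp
      (∑ i ∈ Finset.range k, z i * ((X (u (i + 1)) ω - X (u i) ω : ℝ) : ℂ))) Q ∧
    ∫ ω, Complex.exp
      (∑ i ∈ Finset.range k, z i * ((X (u (i + 1)) ω - X (u i) ω : ℝ) : ℂ)) ∂Q =
      Complex.exp (∑ i ∈ Finset.range k, ((u (i + 1) - u i : ℝ) : ℂ) * ψ (z i))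

section JointExponent

variable {Ω : Type*} [MeasurableSpace Ω] {T : ℝ≥0∞} {X : ℝ≥0 → Ω → ℝ} {Q : Measure Ω} {ψ : ℂ → ℂ}

lemma HasJointExponent.increment (h : HasJointExponent T X Q ψ) {s t : ℝ≥0} (hst : s ≤ t)
    (ht : (t : ℝ≥0∞) ≤ T) (z : ℂ) :
    Integrable (fun ω => Complex.exp (z * ((X t ω - X s ω : ℝ) : ℂ))) Q ∧
      ∫ ω, Complex.exp (z * ((X t ω - X s ω : ℝ) : ℂ)) ∂Q =
        Complex.exp (((t : ℝ) - s : ℝ) * ψ z) := by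
  have hu : Monotone (fun i : ℕ => if i = 0 then s else t) := by
    refine monotone_nat_of_le_succ fun i => ?_
    rcases i with _ | i <;> simp [hst]
  have hT : ∀ i : ℕ, (((if i = 0 then s else t : ℝ≥0)) : ℝ≥0∞) ≤ T := by
    intro i
    split_ifs
    · exact le_trans (by exact_mod_cast hst) ht
    · exact ht
  simpa using h 1 _ hu hT fun _ => z

lemma HasJointExponent.hasExponent (h : HasJointExponent T X Q ψ) (h0 : ∀ᵐ ω ∂Q, X 0 ω = 0) :
    HasExponent T X Q ψ := by
  intro t ht z
  obtain ⟨h1, h2⟩ := h.increment (zero_le (a := t)) ht z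
  have hae : (fun ω => Complex.exp (z * ((X t ω - X 0 ω : ℝ) : ℂ))) =ᵐ[Q]
      fun ω => Complex.exp (z * (X t ω : ℂ)) := by
    filter_upwards [h0] with ω hω
    rw [hω, sub_zero]
  refine ⟨h1.congr hae, ?_⟩
  rw [← integral_congr_ae hae, h2]
  simp

lemma HasJointExponent.charFun_increment (h : HasJointExponent T X Q ψ)
    (hX : ∀ t : ℝ≥0, (t : ℝ≥0∞) ≤ T → Measurable (X t)) {s t : ℝ≥0} (hst : s ≤ t)
    (ht : (t : ℝ≥0∞) ≤ T) (r : ℝ) :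
    charFun (Q.map fun ω => X t ω - X s ω) r =
      Complex.exp (((t : ℝ) - s : ℝ) * ψ (Complex.I * r)) := by
  have hs : (s : ℝ≥0∞) ≤ T := le_trans (by exact_mod_cast hst) ht
  have hm : Measurable fun ω => X t ω - X s ω := (hX t ht).sub (hX s hs)
  rw [← (h.increment hst ht (Complex.I * r)).2, charFun_apply_real,
    integral_map hm.aemeasurable (by fun_prop)]
  congr with ω
  congr 1
  ring

/-- The joint exponent evaluated at imaginary arguments is the joint characteristic function of
the increments, which factorizes. -/
lemma HasJointExponent.hasIndepIncrements [IsProbabilityMeasure Q] (h : HasJointExponent T X Q ψ)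
    (hX : ∀ t : ℝ≥0, (t : ℝ≥0∞) ≤ T → Measurable (X t)) :
    HasIndepIncrements (fun (t : {t : ℝ≥0 // (t : ℝ≥0∞) ≤ T}) => X t) Q := by
  intro n t ht
  have hm : ∀ i : Fin n, Measurable fun ω => X (t i.succ) ω - X (t i.castSucc) ω := fun i =>
    (hX _ (t i.succ).2).sub (hX _ (t i.castSucc).2)
  rw [iIndepFun_iff_charFun_pi fun i => (hm i).aemeasurable]
  intro r
  let u : ℕ → ℝ≥0 := fun k => t ⟨min k n, by omega⟩
  have hu : Monotone u := fun a b hab => ht (by simp only [Fin.mk_le_mk]; omega)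
  let z : ℕ → ℂ := fun k => if hk : k < n then Complex.I * (r ⟨k, hk⟩ : ℂ) else 0
  have hus : ∀ i : Fin n, u (i + 1) = t i.succ := fun i => by
    simp only [u]; congr 2; simp only [Fin.ext_iff, Fin.val_succ]; omega
  have huc : ∀ i : Fin n, u i = t i.castSucc := fun i => by
    simp only [u]; congr 2; simp only [Fin.ext_iff, Fin.val_castSucc]; omega
  have hz : ∀ i : Fin n, z i = Complex.I * (r i : ℂ) := fun i => by simp [z]
  have key := (h n u hu (fun i => (t _).2) z).2
  simp only [Finset.sum_range, hus, huc, hz] at key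
  have hm' : Measurable fun ω => WithLp.toLp 2
      (fun i : Fin n => X (t i.succ) ω - X (t i.castSucc) ω) :=
    (PiLp.continuous_toLp 2 _).measurable.comp (measurable_pi_lambda _ hm)
  rw [charFun_apply, integral_map hm'.aemeasurable (by fun_prop)]
  simp_rw [fun i : Fin n => h.charFun_increment hX (ht (Fin.castSucc_lt_succ (i := i)).le)
    (t i.succ).2 (r i)]
  rw [← Complex.exp_sum, ← key]
  congr with ω
  congr 1
  simp only [PiLp.inner_apply, Complex.ofReal_sum, Finset.sum_mul]
  refine Finset.sum_congr rfl fun i _ => ?_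
  simp
  ring

lemma HasJointExponent.map_increment (h : HasJointExponent T X Q ψ) [IsProbabilityMeasure Q]
    (hX : ∀ t : ℝ≥0, (t : ℝ≥0∞) ≤ T → Measurable (X t)) (h0 : ∀ᵐ ω ∂Q, X 0 ω = 0)
    {s r : ℝ≥0} (hsr : ((s + r : ℝ≥0) : ℝ≥0∞) ≤ T) :
    Q.map (fun ω => X (s + r) ω - X s ω) = Q.map (X r) := by
  have hs : (s : ℝ≥0∞) ≤ T := le_trans (by exact_mod_cast le_self_add) hsr
  have hr : (r : ℝ≥0∞) ≤ T := le_trans (by exact_mod_cast le_add_self) hsr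
  have hae : X r =ᵐ[Q] fun ω => X r ω - X 0 ω := by
    filter_upwards [h0] with ω hω
    rw [hω, sub_zero]
  have := Measure.isProbabilityMeasure_map (μ := Q) ((hX _ hsr).sub (hX s hs)).aemeasurable
  have := Measure.isProbabilityMeasure_map (μ := Q) ((hX r hr).sub (hX 0 (by simp))).aemeasurable
  rw [Measure.map_congr hae]
  refine Measure.ext_of_charFun ?_
  ext x
  rw [h.charFun_increment hX le_self_add hsr, h.charFun_increment hX (zero_le (a := r)) hr]
  simp

/-- A process which starts at `0`, almost surely has nondecreasing right-continuous paths and has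
a joint exponent is a Lévy process. -/
lemma HasJointExponent.isLevyProcess (h : HasJointExponent T X Q ψ) [IsProbabilityMeasure Q]
    (hX : ∀ t : ℝ≥0, (t : ℝ≥0∞) ≤ T → Measurable (X t)) (h0 : ∀ᵐ ω ∂Q, X 0 ω = 0)
    (hpath : ∀ᵐ ω ∂Q, Monotone (fun t => X t ω) ∧
      ∀ t, ContinuousWithinAt (fun s => X s ω) (Set.Ici t) t) :
    IsLevyProcess T X Q where
  isProbabilityMeasure := inferInstance
  measurable := hX
  zero := h0
  indep := h.hasIndepIncrements hX
  stationary _ _ hsr := h.map_increment hX h0 hsr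
  cadlag := by
    filter_upwards [hpath] with ω hω t _
    exact ⟨(hω.2 t).mono fun s hs => hs.1, _, hω.1.tendsto_nhdsLT t⟩

end JointExponent

/-! ### Independence of the past -/

section NaturalFiltration

/-- Every finite set of times in `[0, s]` is covered by a nondecreasing sequence starting at `0`
which equals `s` and then `t ≥ s` from some index on. -/
lemma exists_monotone_times {s t : ℝ≥0} (hst : s ≤ t) (I : Finset ℝ≥0) (hI : ∀ j ∈ I, j ≤ s) :
    ∃ (u : ℕ → ℝ≥0) (k : ℕ), Monotone u ∧ u 0 = 0 ∧ u k = s ∧ u (k + 1) = t ∧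
      ∀ j ∈ I, ∃ i ≤ k, u i = j := by
  have extend : ∀ (u : ℕ → ℝ≥0) (k : ℕ) (a : ℝ≥0), Monotone u → u k ≤ a →
      Monotone (fun i => if i ≤ k then u i else a) := by
    intro u k a hu hk
    refine monotone_nat_of_le_succ fun i => ?_
    split_ifs with h1 h2 h2
    · exact hu (Nat.le_succ i)
    · exact (hu h1).trans hk
    · omega
    · exact le_rfl
  have main : ∀ I : Finset ℝ≥0, (∀ j ∈ I, j ≤ s) → ∃ (u : ℕ → ℝ≥0) (k : ℕ), Monotone u ∧ u 0 = 0 ∧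
      u k ∈ insert 0 I ∧ ∀ j ∈ I, ∃ i ≤ k, u i = j := by
    intro I
    refine Finset.induction_on_max I ?_ ?_
    · exact fun _ => ⟨fun _ => 0, 0, monotone_const, rfl, by simp, by simp⟩
    · intro a I ha ih hI
      obtain ⟨u, k, hu, hu0, huk, hcov⟩ := ih fun j hj => hI j (Finset.mem_insert_of_mem hj)
      have hka : u k ≤ a := by
        rcases Finset.mem_insert.1 huk with h | h
        · rw [h]; exact zero_le
        · exact (ha _ h).le
      refine ⟨fun i => if i ≤ k then u i else a, k + 1, extend u k a hu hka, by simp [hu0],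
        by simp, fun j hj => ?_⟩
      rcases Finset.mem_insert.1 hj with rfl | hj
      · exact ⟨k + 1, le_rfl, by simp⟩
      · obtain ⟨i, hik, hi⟩ := hcov j hj
        exact ⟨i, by omega, by simp [hik, hi]⟩
  obtain ⟨u, k, hu, hu0, huk, hcov⟩ := main I hI
  have hks : u k ≤ s := by
    rcases Finset.mem_insert.1 huk with h | h
    · rw [h]; exact zero_le
    · exact hI _ h
  have hv := extend u k s hu hks
  refine ⟨fun i => if i ≤ k + 1 then (if i ≤ k then u i else s) else t, k + 1,
    extend _ (k + 1) t hv (by simpa using hst), by simp [hu0], by simp, by simp, fun j hj => ?_⟩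
  obtain ⟨i, hik, hi⟩ := hcov j hj
  exact ⟨i, by omega, by simp [hik, hi, Nat.le_succ_of_le hik]⟩

/-- For a process with independent increments and `X_0 = 0`, the increment over `[s, t]` is
independent of the path up to time `s`. -/
lemma indepFun_increment_past {Ω : Type*} [MeasurableSpace Ω] {X : ℝ≥0 → Ω → ℝ} {Q : Measure Ω}
    [IsProbabilityMeasure Q] (hX : ∀ t, Measurable (X t)) (h0 : ∀ᵐ ω ∂Q, X 0 ω = 0)
    (hindep : HasIndepIncrements X Q) {s t : ℝ≥0} (hst : s ≤ t) :
    IndepFun (fun ω => X t ω - X s ω) (fun ω (j : Set.Iic s) => X j ω) Q := by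
  refine IndepFun.indepFun_process ((hX t).sub (hX s)) (fun j => hX j) fun I => ?_
  obtain ⟨u, k, hu, hu0, huk, huk1, hcov⟩ := exists_monotone_times hst (I.image Subtype.val)
    (by simp only [Finset.mem_image]; rintro _ ⟨j, _, rfl⟩; exact j.2)
  choose! c hck hc using hcov
  have hD := hindep.nat hu
  have h1 := hD.indepFun_finset {k} (Finset.range k) (by simp)
    fun i => (hX _).sub (hX _)
  let f : (({k} : Finset ℕ) → ℝ) → ℝ := fun y => y ⟨k, by simp⟩
  -- the value at the time `u (c j)` is the sum of the preceding increments
  let g : (↥(Finset.range k) → ℝ) → I → ℝ := fun y j =>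
    ∑ i ∈ Finset.range (c j), if hi : i ∈ Finset.range k then y ⟨i, hi⟩ else 0
  have hf : Measurable f := measurable_pi_apply _
  have hg : Measurable g := by
    refine measurable_pi_lambda _ fun j => Finset.measurable_fun_sum _ fun i _ => ?_
    by_cases hi : i ∈ Finset.range k
    · simpa only [hi, dite_true] using measurable_pi_apply _
    · simpa only [hi, dite_false] using measurable_const
  refine (h1.comp hf hg).congr ?_ ?_
  · refine ae_of_all _ fun ω => ?_
    simp [f, huk, huk1]
  · filter_upwards [h0] with ω hω
    funext j
    have hj : (j : ℝ≥0) ∈ I.image Subtype.val := Finset.mem_image_of_mem _ j.2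
    have : ∀ i ∈ Finset.range (c j), i ∈ Finset.range k := fun i hi => by
      have := hck _ hj
      simp only [Finset.mem_range] at *
      omega
    simp only [Function.comp_apply, g]
    rw [Finset.sum_congr rfl fun i hi => dif_pos (this i hi), Finset.sum_range_sub
      (fun i => X (u i) ω), hc _ hj, hu0, hω, sub_zero]

end NaturalFiltration

/-! ### The Poisson process -/

section Poisson

lemma integrable_cexp_poissonMeasure (r : ℝ≥0) (z : ℂ) :
    Integrable (fun k : ℕ => Complex.exp (z * k)) (poissonMeasure r) := by
  rw [integrable_poissonMeasure_iff]
  have := (NormedSpace.expSeries_div_summable (r * Real.exp z.re)).mul_left (Real.exp (-r))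
  refine this.congr fun k => ?_
  rw [Complex.norm_exp, mul_pow, ← Real.exp_nat_mul]
  simp only [Complex.mul_re, Complex.natCast_re, Complex.natCast_im, mul_zero, sub_zero]
  ring_nf

lemma integral_cexp_poissonMeasure (r : ℝ≥0) (z : ℂ) :
    ∫ k : ℕ, Complex.exp (z * k) ∂(poissonMeasure r) = Complex.exp (r * (Complex.exp z - 1)) := by
  rw [integral_poissonMeasure]
  have h : ∀ k : ℕ, (Real.exp (-r) * r ^ k / k.factorial) • Complex.exp (z * k) =
      Complex.exp (-r) * ((r * Complex.exp z) ^ k / k.factorial) := fun k => by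
    rw [Complex.real_smul, mul_pow, ← Complex.exp_nat_mul, mul_comm z]
    push_cast
    ring
  simp_rw [h]
  rw [tsum_mul_left, (NormedSpace.expSeries_div_hasSum_exp ((r : ℂ) * Complex.exp z)).tsum_eq,
    ← Complex.exp_eq_exp_ℂ, ← Complex.exp_add]
  ring_nf

lemma integrable_prod_comp_of_iIndepFun {Ω ι : Type*} [Fintype ι] [MeasurableSpace Ω]
    {P : Measure Ω} {X : ι → Ω → ℝ} {f : ι → ℝ → ℂ} (hX : iIndepFun X P)
    (mX : ∀ i, Measurable (X i)) (mf : ∀ i, Measurable (f i))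
    (hf : ∀ i, Integrable (fun ω => f i (X i ω)) P) :
    Integrable (fun ω => ∏ i, f i (X i ω)) P := by
  have := hX.isProbabilityMeasure
  have hm : Measurable fun ω i => X i ω := measurable_pi_lambda _ mX
  have key : Integrable (fun x : ι → ℝ => ∏ i, f i (x i)) (Measure.pi fun i => P.map (X i)) := by
    have := fun i => Measure.isProbabilityMeasure_map (μ := P) (mX i).aemeasurable
    exact Integrable.fintype_prod_dep fun i =>
      (integrable_map_measure (mf i).aestronglyMeasurable (mX i).aemeasurable).2 (hf i)
  rw [← hX.map_fun_eq_pi_map fun i => (mX i).aemeasurable] at key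
  exact (integrable_map_measure key.1 hm.aemeasurable).1 key

variable {Ω : Type*} [MeasurableSpace Ω] {P : Measure Ω}

lemma IsPoissonProcess.hasJointExponent {N : ℝ≥0 → Ω → ℕ} {lam : ℝ≥0}
    (hN : IsPoissonProcess N lam P) :
    HasJointExponent ∞ (fun t ω => (N t ω : ℝ)) P
      (fun z => (lam : ℝ) * Complex.exp z - (lam : ℝ)) := by
  intro k u hu _ z
  have hm : ∀ t, Measurable fun ω => (N t ω : ℝ) := fun t =>
    (measurable_from_nat (f := fun k : ℕ => (k : ℝ))).comp (hN.measurable t)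
  have hinc : ∀ i : ℕ,
      Integrable (fun ω => Complex.exp (z i * ((N (u (i + 1)) ω - N (u i) ω : ℝ) : ℂ))) P ∧
      ∫ ω, Complex.exp (z i * ((N (u (i + 1)) ω - N (u i) ω : ℝ) : ℂ)) ∂P =
        Complex.exp (((u (i + 1) - u i : ℝ) : ℂ) *
          ((lam : ℝ) * Complex.exp (z i) - (lam : ℝ))) := by
    intro i
    have hD : Measurable fun ω => (N (u (i + 1)) ω : ℝ) - N (u i) ω := (hm _).sub (hm _)
    have hlaw := hN.law (u i) (u (i + 1)) (hu (Nat.le_succ i))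
    have hf : Measurable fun x : ℝ => Complex.exp (z i * (x : ℂ)) := by fun_prop
    have hc : Measurable fun k : ℕ => (k : ℝ) := measurable_from_nat
    constructor
    · have h1 : Integrable (fun x : ℝ => Complex.exp (z i * (x : ℂ)))
          (P.map fun ω => (N (u (i + 1)) ω : ℝ) - N (u i) ω) := by
        rw [hlaw, integrable_map_measure hf.aestronglyMeasurable hc.aemeasurable]
        simpa [Function.comp_def] using integrable_cexp_poissonMeasure _ (z i)
      exact (integrable_map_measure hf.aestronglyMeasurable hD.aemeasurable).1 h1
    · rw [← integral_map (f := fun x : ℝ => Complex.exp (z i * (x : ℂ))) hD.aemeasurable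
        hf.aestronglyMeasurable, hlaw, integral_map hc.aemeasurable hf.aestronglyMeasurable]
      simp only [Complex.ofReal_natCast]
      rw [integral_cexp_poissonMeasure]
      congr 1
      rw [NNReal.coe_mul, NNReal.coe_sub (hu (Nat.le_succ i))]
      push_cast
      ring
  have hind : iIndepFun (fun (i : Fin k) ω => (N (u (i + 1)) ω : ℝ) - N (u i) ω) P :=
    (hN.indep.nat hu).precomp Fin.val_injective
  have hDm : ∀ i : Fin k, Measurable fun ω => (N (u (i + 1)) ω : ℝ) - N (u i) ω :=
    fun i => (hm _).sub (hm _)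
  have hfm : ∀ i : Fin k, Measurable fun x : ℝ => Complex.exp (z i * (x : ℂ)) :=
    fun i => by fun_prop
  simp only [Finset.sum_range, Complex.exp_sum]
  refine ⟨integrable_prod_comp_of_iIndepFun hind hDm hfm fun i => (hinc i).1, ?_⟩
  rw [hind.integral_fun_prod_comp (f := fun (i : Fin k) (x : ℝ) => Complex.exp (z i * (x : ℂ)))
    (fun i => (hDm i).aemeasurable) fun i => (hfm i).aestronglyMeasurable]
  exact Finset.prod_congr rfl fun i _ => (hinc i).2

end Poisson

/-! ### Subordination by an independent integer-valued process -/

section Composition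

lemma measurable_eval_nat {α : Type*} [MeasurableSpace α] :
    Measurable fun p : ℕ × (ℕ → α) => p.2 p.1 :=
  measurable_from_prod_countable_right fun n => measurable_pi_apply n

variable {Ω : Type*} [MeasurableSpace Ω] {P : Measure Ω}

/-- Subordination: if the `ℕ`-valued process `N` with nondecreasing paths is independent of `W`,
then the exponent of the time-changed process `t ↦ W (N t)` is the composition of the exponents.
Conditionally on `N`, the joint exponential of the increments of `W` along the times `N (u i)` is
`exp (∑ (N (u (i + 1)) - N (u i)) φ (z i))`, and the joint exponent of `N` applies. -/
lemma HasJointExponent.comp [IsProbabilityMeasure P] {N : ℝ≥0 → Ω → ℕ} {W : ℝ≥0 → Ω → ℝ}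
    {φ χ : ℂ → ℂ} (hNm : ∀ t, Measurable (N t)) (hWm : ∀ t, Measurable (W t))
    (hmono : ∀ᵐ ω ∂P, Monotone fun t => N t ω)
    (hind : IndepFun (fun ω t => N t ω) (fun ω t => W t ω) P)
    (hN : HasJointExponent ∞ (fun t ω => (N t ω : ℝ)) P χ) (hW : HasJointExponent ∞ W P φ) :
    HasJointExponent ∞ (fun t ω => W (N t ω) ω) P (χ ∘ φ) := by
  intro k u hu _ z
  let K : Ω → ℕ → ℕ := fun ω i => N (u i) ω
  let w : Ω → ℕ → ℝ := fun ω j => W j ω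
  have hK : Measurable K := measurable_pi_lambda _ fun i => hNm _
  have hw : Measurable w := measurable_pi_lambda _ fun j => hWm _
  have hKw : IndepFun K w P :=
    hind.comp (φ := fun p i => p (u i)) (ψ := fun p (j : ℕ) => p j)
      (measurable_pi_lambda _ fun i => measurable_pi_apply _)
      (measurable_pi_lambda _ fun j => measurable_pi_apply _)
  let f : (ℕ → ℂ) → (ℕ → ℕ) × (ℕ → ℝ) → ℂ := fun z p => Complex.exp
    (∑ i ∈ Finset.range k, z i * ((p.2 (p.1 (i + 1)) - p.2 (p.1 i) : ℝ) : ℂ))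
  have hfm : ∀ z, Measurable (f z) := by
    intro z
    have hev : ∀ i, Measurable fun p : (ℕ → ℕ) × (ℕ → ℝ) => p.2 (p.1 i) := fun i =>
      measurable_eval_nat.comp (g := fun p : ℕ × (ℕ → ℝ) => p.2 p.1)
        (f := fun p : (ℕ → ℕ) × (ℕ → ℝ) => (p.1 i, p.2))
        (((measurable_pi_apply i).comp measurable_fst).prodMk measurable_snd)
    exact Complex.measurable_exp.comp (Finset.measurable_fun_sum _ fun i _ =>
      (Complex.measurable_ofReal.comp ((hev _).sub (hev _))).const_mul _)
  have := Measure.isProbabilityMeasure_map (μ := P) hK.aemeasurable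
  have := Measure.isProbabilityMeasure_map (μ := P) hw.aemeasurable
  have hprod : P.map (fun ω => (K ω, w ω)) = (P.map K).prod (P.map w) :=
    hKw.map_prod_eq_prod_map_map hK.aemeasurable hw.aemeasurable
  have hKmono : ∀ᵐ κ ∂(P.map K), Monotone κ := by
    have hs : MeasurableSet {κ : ℕ → ℕ | ∀ i, κ i ≤ κ (i + 1)} := by
      rw [Set.ofPred_forall]
      exact MeasurableSet.iInter fun i =>
        measurableSet_le (measurable_pi_apply _) (measurable_pi_apply _)
    have : ∀ᵐ κ ∂(P.map K), ∀ i, κ i ≤ κ (i + 1) := by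
      refine (ae_map_iff hK.aemeasurable hs).2 ?_
      filter_upwards [hmono] with ω hω i using hω (hu (Nat.le_succ i))
    filter_upwards [this] with κ hκ using monotone_nat_of_le_succ hκ
  -- conditionally on the times `κ`
  have hsec : ∀ (z : ℕ → ℂ) (κ : ℕ → ℕ), Monotone κ →
      Integrable (fun y => f z (κ, y)) (P.map w) ∧ ∫ y, f z (κ, y) ∂(P.map w) = Complex.exp
        (∑ i ∈ Finset.range k, φ (z i) * (((κ (i + 1) : ℝ) - κ i : ℝ) : ℂ)) := by
    intro z κ hκ
    have hm : Measurable fun y => f z (κ, y) := (hfm z).comp measurable_prodMk_left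
    obtain ⟨h1, h2⟩ := hW k (fun i => (κ i : ℝ≥0)) (fun a b hab => by simpa using hκ hab)
      (fun i => le_top) z
    refine ⟨(integrable_map_measure hm.aestronglyMeasurable hw.aemeasurable).2 h1, ?_⟩
    rw [integral_map hw.aemeasurable hm.aestronglyMeasurable]
    refine h2.trans ?_
    congr 1
    refine Finset.sum_congr rfl fun i _ => ?_
    rw [mul_comm, NNReal.coe_natCast, NNReal.coe_natCast]
  have htime : ∀ c : ℕ → ℂ, Integrable (fun κ : ℕ → ℕ => Complex.exp
        (∑ i ∈ Finset.range k, c i * (((κ (i + 1) : ℝ) - κ i : ℝ) : ℂ))) (P.map K) ∧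
      ∫ κ, Complex.exp (∑ i ∈ Finset.range k, c i * (((κ (i + 1) : ℝ) - κ i : ℝ) : ℂ)) ∂(P.map K) =
        Complex.exp (∑ i ∈ Finset.range k, ((u (i + 1) - u i : ℝ) : ℂ) * χ (c i)) := by
    intro c
    have hc : ∀ i, Measurable fun κ : ℕ → ℕ => (κ i : ℝ) := fun i =>
      (measurable_from_nat (f := fun k : ℕ => (k : ℝ))).comp (measurable_pi_apply i)
    have hm : Measurable fun κ : ℕ → ℕ => Complex.exp
        (∑ i ∈ Finset.range k, c i * (((κ (i + 1) : ℝ) - κ i : ℝ) : ℂ)) :=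
      Complex.measurable_exp.comp (Finset.measurable_fun_sum _ fun i _ =>
        (Complex.measurable_ofReal.comp ((hc _).sub (hc _))).const_mul _)
    obtain ⟨h1, h2⟩ := hN k u hu (fun i => le_top) c
    refine ⟨(integrable_map_measure hm.aestronglyMeasurable hK.aemeasurable).2 h1, ?_⟩
    rw [integral_map hK.aemeasurable hm.aestronglyMeasurable]
    exact h2
  have hint : Integrable (f z) ((P.map K).prod (P.map w)) := by
    rw [integrable_prod_iff (hfm z).aestronglyMeasurable]
    refine ⟨by filter_upwards [hKmono] with κ hκ using (hsec z κ hκ).1, ?_⟩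
    -- the modulus of the exponential is the exponential with the real parts of the `z i`
    refine (htime fun i => φ ((z i).re : ℂ)).1.re.congr ?_
    filter_upwards [hKmono] with κ hκ
    rw [← (hsec (fun i => ((z i).re : ℂ)) κ hκ).2]
    have : ∀ y, f (fun i => ((z i).re : ℂ)) (κ, y) = ((‖f z (κ, y)‖ : ℝ) : ℂ) := by
      intro y
      simp only [f, Complex.norm_exp, Complex.re_sum, Complex.re_mul_ofReal]
      push_cast
      rfl
    simp_rw [this]
    rw [integral_complex_ofReal]
    exact Complex.ofReal_re _
  have hKwm : Measurable fun ω => (K ω, w ω) := hK.prodMk hw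
  constructor
  · have h := hint
    rw [← hprod] at h
    exact (integrable_map_measure (hfm z).aestronglyMeasurable hKwm.aemeasurable).1 h
  · have h1 : ∫ ω, f z (K ω, w ω) ∂P = ∫ p, f z p ∂((P.map K).prod (P.map w)) := by
      rw [← hprod, integral_map hKwm.aemeasurable (hfm z).aestronglyMeasurable]
    refine h1.trans ?_
    rw [integral_prod _ hint]
    refine Eq.trans ?_ (htime fun i => φ (z i)).2
    exact integral_congr_ae (by filter_upwards [hKmono] with κ hκ using (hsec z κ hκ).2)

end Composition

/-! ### The iterated process -/

section Iterated

/-- Reading the iteration from the inside: `V⁽ᵐ⁺¹⁾_t = W_{N¹_t}`, where `W` is the `m`-fold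
iteration of the processes `N², N³, …`. -/
lemma mipp_succ_eq_shift {Ω : Type*} (N : ℕ → ℝ≥0 → Ω → ℕ) (m : ℕ) (t : ℝ≥0) (ω : Ω) :
    mipp N (m + 1) t ω = mipp (fun i => N (i + 1)) m (N 1 t ω) ω := by
  induction m with
  | zero => rfl
  | succ m ih =>
    rw [mipp, ih]
    rfl

variable {Ω : Type*} [MeasurableSpace Ω] {P : Measure Ω} {lam : ℝ≥0}

lemma forall_shift {p : ℕ → Prop} {m : ℕ} (h : ∀ i ∈ Finset.Icc 1 (m + 1), p i) :
    ∀ i ∈ Finset.Icc 1 m, p (i + 1) := fun i hi =>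
  h (i + 1) (by simp only [Finset.mem_Icc] at hi ⊢; omega)

lemma iIndepFun_shift {N : ℕ → ℝ≥0 → Ω → ℕ} {m : ℕ}
    (h : iIndepFun (fun (i : Finset.Icc 1 (m + 1)) ω t => N i t ω) P) :
    iIndepFun (fun (i : Finset.Icc 1 m) ω t => N (i + 1) t ω) P := by
  have hmem : ∀ i : Finset.Icc 1 m, (i : ℕ) + 1 ∈ Finset.Icc 1 (m + 1) := fun i => by
    have := Finset.mem_Icc.1 i.2
    rw [Finset.mem_Icc]; omega
  refine h.precomp (g := fun i : Finset.Icc 1 m => (⟨(i : ℕ) + 1, hmem i⟩ : Finset.Icc 1 (m + 1)))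
    fun i j hij => ?_
  simp only [Subtype.mk.injEq] at hij
  exact Subtype.ext (by omega)

lemma indepFun_fst_shift {N : ℕ → ℝ≥0 → Ω → ℕ} {m : ℕ}
    (hN : ∀ i ∈ Finset.Icc 1 (m + 1), ∀ t, Measurable (N i t))
    (h : iIndepFun (fun (i : Finset.Icc 1 (m + 1)) ω t => N i t ω) P) :
    IndepFun (fun ω t => N 1 t ω) (fun ω s => mipp (fun i => N (i + 1)) m s ω) P := by
  let a : Finset.Icc 1 (m + 1) := ⟨1, by simp⟩
  let σ : Finset.Icc 1 (m + 1) → MeasurableSpace Ω := fun i =>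
    MeasurableSpace.comap (fun ω t => N i t ω) inferInstance
  have hσ : ∀ i, σ i ≤ ‹MeasurableSpace Ω› := fun i =>
    (measurable_pi_lambda _ fun t => hN i i.2 t).comap_le
  have hI : Indep (⨆ i ∈ ({a} : Set _), σ i) (⨆ i ∈ ({a}ᶜ : Set _), σ i) P :=
    indep_iSup_of_disjoint hσ h.iIndep disjoint_compl_right
  refine indep_of_indep_of_le_left (indep_of_indep_of_le_right hI ?_) ?_
  · refine Measurable.comap_le (@measurable_pi_lambda _ _ _ (_) _ _ fun s => ?_)
    refine @measurable_mipp Ω (⨆ i ∈ ({a}ᶜ : Set _), σ i) _ m (fun i hi t => ?_) s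
    have hi' : i + 1 ∈ Finset.Icc 1 (m + 1) := by
      simp only [Finset.mem_Icc] at hi ⊢; omega
    let b : Finset.Icc 1 (m + 1) := ⟨i + 1, hi'⟩
    have hb : b ∈ ({a}ᶜ : Set (Finset.Icc 1 (m + 1))) := by
      have := (Finset.mem_Icc.1 hi).1
      simp only [Set.mem_compl_iff, Set.mem_singleton_iff, a, b, Subtype.mk.injEq]
      omega
    have h1 : Measurable[σ b] (N (i + 1) t) :=
      (measurable_pi_apply t).comp (comap_measurable fun ω t => N (i + 1) t ω)
    exact h1.mono (le_iSup₂_of_le b hb le_rfl) le_rfl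
  · exact le_iSup₂_of_le a rfl le_rfl

lemma measurable_V {N : ℕ → ℝ≥0 → Ω → ℕ} {n : ℕ}
    (hN : ∀ i ∈ Finset.Icc 1 n, ∀ t, Measurable (N i t)) (t : ℝ≥0) : Measurable (V N n t) :=
  NNReal.continuous_coe.measurable.comp (measurable_mipp hN t)

/-- The exponent of `V⁽ⁿ⁾` is `ℓ_n`, also jointly in the increments. -/
lemma hasJointExponent_V [IsProbabilityMeasure P] {n : ℕ} {N : ℕ → ℝ≥0 → Ω → ℕ}
    (hN : ∀ i ∈ Finset.Icc 1 n, IsPoissonProcess (N i) lam P)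
    (hindep : iIndepFun (fun (i : Finset.Icc 1 n) ω t => N i t ω) P) :
    HasJointExponent ∞ (V N n) P (ellC lam n) := by
  induction n generalizing N with
  | zero =>
    intro k u _ _ z
    simp only [V, mipp, ellC]
    refine ⟨integrable_const _, ?_⟩
    rw [integral_const, probReal_univ, one_smul]
    congr 1
    exact Finset.sum_congr rfl fun i _ => mul_comm _ _
  | succ m ih =>
    have hN1 := hN 1 (by simp)
    have hshift := forall_shift hN
    have hV : V N (m + 1) = fun t ω => V (fun i => N (i + 1)) m (N 1 t ω) ω := by
      funext t ω
      simp only [V, mipp_succ_eq_shift]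
    have hind : IndepFun (fun ω t => N 1 t ω) (fun ω t => V (fun i => N (i + 1)) m t ω) P :=
      (indepFun_fst_shift (fun i hi => (hN i hi).measurable) hindep).comp
        (φ := id) (ψ := fun (p : ℝ≥0 → ℝ≥0) (t : ℝ≥0) => ((p t : ℝ≥0) : ℝ)) measurable_id
        (measurable_pi_lambda _ fun t =>
          NNReal.continuous_coe.measurable.comp (measurable_pi_apply t))
    rw [hV]
    exact HasJointExponent.comp hN1.measurable (measurable_V fun i hi => (hshift i hi).measurable)
      (hN1.path.mono fun ω h => h.1) hind hN1.hasJointExponent (ih hshift (iIndepFun_shift hindep))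

lemma ae_V_zero {n : ℕ} {N : ℕ → ℝ≥0 → Ω → ℕ}
    (hN : ∀ i ∈ Finset.Icc 1 n, IsPoissonProcess (N i) lam P) : ∀ᵐ ω ∂P, V N n 0 ω = 0 := by
  induction n with
  | zero => exact ae_of_all _ fun ω => by simp [V, mipp]
  | succ m ih =>
    have h := hN (m + 1) (by simp)
    filter_upwards [ih fun i hi => hN i (by simp only [Finset.mem_Icc] at hi ⊢; omega), h.zero]
      with ω h1 h2
    have h1' : mipp N m 0 ω = 0 := NNReal.coe_eq_zero.1 h1
    simp [V, mipp, h1', h2]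

lemma ae_path_mipp {n : ℕ} {N : ℕ → ℝ≥0 → Ω → ℕ}
    (hN : ∀ i ∈ Finset.Icc 1 n, IsPoissonProcess (N i) lam P) :
    ∀ᵐ ω ∂P, Monotone (fun t => mipp N n t ω) ∧
      ∀ t, ContinuousWithinAt (fun s => mipp N n s ω) (Set.Ici t) t := by
  induction n with
  | zero => exact ae_of_all _ fun ω => ⟨fun a b h => h, fun t => continuousWithinAt_id⟩
  | succ m ih =>
    have h := hN (m + 1) (by simp)
    filter_upwards [ih fun i hi => hN i (by simp only [Finset.mem_Icc] at hi ⊢; omega), h.path]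
      with ω h1 h2
    refine ⟨fun a b hab => by simpa [mipp] using h2.1 (h1.1 hab), fun t => ?_⟩
    have hc : ContinuousWithinAt (fun s => N (m + 1) (mipp N m s ω) ω) (Set.Ici t) t :=
      ContinuousWithinAt.comp (f := fun s => mipp N m s ω) (g := fun x => N (m + 1) x ω)
        (h2.2 (mipp N m t ω)) (h1.2 t) fun s hs => h1.1 hs
    exact (continuous_of_discreteTopology (f := fun k : ℕ => (k : ℝ≥0))).continuousAt
      |>.comp_continuousWithinAt hc

lemma ae_path_V {n : ℕ} {N : ℕ → ℝ≥0 → Ω → ℕ}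
    (hN : ∀ i ∈ Finset.Icc 1 n, IsPoissonProcess (N i) lam P) :
    ∀ᵐ ω ∂P, Monotone (fun t => V N n t ω) ∧
      ∀ t, ContinuousWithinAt (fun s => V N n s ω) (Set.Ici t) t := by
  filter_upwards [ae_path_mipp hN] with ω h
  exact ⟨fun a b hab => NNReal.coe_le_coe.2 (h.1 hab), fun t =>
    NNReal.continuous_coe.continuousAt.comp_continuousWithinAt (h.2 t)⟩

end Iterated

/-! ### The Esscher transform -/

section Tilting

/-- Let `v` arise from `u 0, …, u k` by adding the times `0` in front and `T` at the end. Shifting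
all coefficients by `a` adds `a` times the total increment over `[0, T]`. -/
lemma sum_range_extended (F : ℝ≥0 → ℂ) (u v : ℕ → ℝ≥0) (b c : ℕ → ℂ) (a : ℂ) (T : ℝ≥0) (k : ℕ)
    (hv0 : v 0 = 0) (hv : ∀ j ≤ k, v (j + 1) = u j) (hvT : v (k + 2) = T)
    (hc0 : c 0 = a) (hc : ∀ j < k, c (j + 1) = b j + a) (hck : c (k + 1) = a) :
    ∑ i ∈ Finset.range (k + 2), c i * (F (v (i + 1)) - F (v i)) =
      ∑ i ∈ Finset.range k, b i * (F (u (i + 1)) - F (u i)) + a * (F T - F 0) := by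
  rw [Finset.sum_range_succ, Finset.sum_range_succ', hc0, hck, hvT, hv0, hv k le_rfl,
    hv 0 (Nat.zero_le k)]
  have h : ∑ i ∈ Finset.range k, c (i + 1) * (F (v (i + 1 + 1)) - F (v (i + 1))) =
      ∑ i ∈ Finset.range k, b i * (F (u (i + 1)) - F (u i)) +
        a * ∑ i ∈ Finset.range k, (F (u (i + 1)) - F (u i)) := by
    rw [Finset.mul_sum, ← Finset.sum_add_distrib]
    refine Finset.sum_congr rfl fun i hi => ?_
    have hi' := Finset.mem_range.1 hi
    rw [hc i hi', hv i hi'.le, hv (i + 1) hi']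
    ring
  rw [h, Finset.sum_range_sub (fun i => F (u i))]
  ring

variable {Ω : Type*} [MeasurableSpace Ω] {P : Measure Ω}

/-- Esscher transform: under the measure with density `exp (θ X_T - T ψ(θ))` the exponent becomes
`ψ (· + θ) - ψ θ`. The density is absorbed in the joint exponential by adding the times `0`
and `T` to the sequence of times. -/
lemma HasJointExponent.esscher {X : ℝ≥0 → Ω → ℝ} {ψ : ℂ → ℂ} (h : HasJointExponent ∞ X P ψ)
    (hX : ∀ t, Measurable (X t)) (h0 : ∀ᵐ ω ∂P, X 0 ω = 0) (θ c : ℝ) (hc : ψ θ = c) (T : ℝ≥0) :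
    HasJointExponent T X
      (P.withDensity fun ω => ENNReal.ofReal (Real.exp (θ * X T ω - (T : ℝ) * c)))
      (fun z => ψ (z + θ) - ψ θ) := by
  intro k u hu huT z
  have huT' : ∀ i, u i ≤ T := fun i => by exact_mod_cast huT i
  let v : ℕ → ℝ≥0 := fun j => if j = 0 then 0 else if j ≤ k + 1 then u (j - 1) else T
  let y : ℕ → ℂ := fun j => if 0 < j ∧ j ≤ k then z (j - 1) + θ else θ
  have hv : Monotone v := by
    refine monotone_nat_of_le_succ fun j => ?_
    rcases j with _ | j
    · exact zero_le
    · simp only [v, Nat.add_eq_zero_iff, one_ne_zero, and_false, if_false, Nat.add_sub_cancel]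
      split_ifs with h1 h2 h2
      · exact hu (Nat.le_succ j)
      · exact huT' j
      · omega
      · exact le_rfl
  have hv0 : v 0 = 0 := by simp [v]
  have hvj : ∀ j ≤ k, v (j + 1) = u j := fun j hj => by simp [v, hj]
  have hvT : v (k + 2) = T := by simp [v]
  have hy0 : y 0 = θ := by simp [y]
  have hyj : ∀ j < k, y (j + 1) = z j + θ := fun j hj => by
    simp only [y, Nat.succ_pos, Nat.add_sub_cancel, true_and]
    rw [if_pos (by omega)]
  have hyk : y (k + 1) = θ := by simp [y]
  obtain ⟨h1, h2⟩ := h (k + 2) v hv (fun _ => le_top) y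
  have hae : (fun ω => Complex.exp (-(T * c)) * Complex.exp
        (∑ i ∈ Finset.range (k + 2), y i * ((X (v (i + 1)) ω - X (v i) ω : ℝ) : ℂ))) =ᵐ[P]
      fun ω => (ENNReal.ofReal (Real.exp (θ * X T ω - (T : ℝ) * c))).toReal • Complex.exp
        (∑ i ∈ Finset.range k, z i * ((X (u (i + 1)) ω - X (u i) ω : ℝ) : ℂ)) := by
    filter_upwards [h0] with ω hω
    simp only [Complex.ofReal_sub]
    rw [sum_range_extended (fun t => (X t ω : ℂ)) u v z y θ T k hv0 hvj hvT hy0 hyj hyk,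
      ENNReal.toReal_ofReal (Real.exp_nonneg _), Complex.real_smul, Complex.ofReal_exp,
      ← Complex.exp_add, ← Complex.exp_add, hω]
    congr 1
    push_cast
    ring
  have hdm : Measurable fun ω => ENNReal.ofReal (Real.exp (θ * X T ω - (T : ℝ) * c)) :=
    (Real.measurable_exp.comp (((hX T).const_mul θ).sub_const _)).ennreal_ofReal
  have hdt : ∀ᵐ ω ∂P, ENNReal.ofReal (Real.exp (θ * X T ω - (T : ℝ) * c)) < ∞ :=
    ae_of_all _ fun ω => ENNReal.ofReal_lt_top
  refine ⟨(integrable_withDensity_iff_integrable_smul' hdm hdt).2 ((h1.const_mul _).congr hae), ?_⟩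
  rw [integral_withDensity_eq_integral_toReal_smul hdm hdt, ← integral_congr_ae hae,
    integral_const_mul, h2, ← Complex.exp_add]
  congr 1
  simp only [Complex.ofReal_sub]
  simp_rw [mul_comm (_ - _ : ℂ) (ψ _)]
  rw [sum_range_extended (fun t => ((t : ℝ) : ℂ)) u v (fun i => ψ (z i + θ) - ψ θ)
    (fun i => ψ (y i)) (ψ θ) T k hv0 hvj hvT (by rw [hy0]) (fun j hj => by rw [hyj j hj]; ring)
    (by rw [hyk]), hc]
  rw [NNReal.coe_zero, Complex.ofReal_zero, sub_zero,
    Finset.sum_congr rfl fun i _ => mul_comm ((u (i + 1) : ℂ) - u i) (ψ (z i + θ) - c)]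
  ring

lemma ellC_ofReal (lam : ℝ≥0) (n : ℕ) (θ : ℝ) : ellC lam n (θ : ℂ) = (ell lam n θ : ℂ) := by
  induction n with
  | zero => rfl
  | succ m ih =>
    rw [ellC, ih, ell]
    push_cast
    rfl

lemma ellC_zero (lam : ℝ≥0) (n : ℕ) : ellC lam n 0 = 0 := by
  induction n with
  | zero => rfl
  | succ m ih => rw [ellC, ih]; simp

/-- The real exponential moments of the increments, read off from the joint exponent. -/
lemma HasJointExponent.real_exp_increment {X : ℝ≥0 → Ω → ℝ} {ψ : ℂ → ℂ}
    (h : HasJointExponent ∞ X P ψ) {θ c : ℝ} (hc : ψ θ = c) {s t : ℝ≥0} (hst : s ≤ t) :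
    Integrable (fun ω => Real.exp (θ * (X t ω - X s ω))) P ∧
      ∫ ω, Real.exp (θ * (X t ω - X s ω)) ∂P = Real.exp ((t - s) * c) := by
  obtain ⟨h1, h2⟩ := h.increment hst le_top θ
  have hre : ∀ ω, Complex.exp ((θ : ℂ) * ((X t ω - X s ω : ℝ) : ℂ)) =
      ((Real.exp (θ * (X t ω - X s ω)) : ℝ) : ℂ) := fun ω => by push_cast; rfl
  simp_rw [hre] at h1 h2
  constructor
  · exact h1.re
  · rw [integral_complex_ofReal, hc] at h2
    exact_mod_cast h2

variable {lam : ℝ≥0} {n : ℕ} {N : ℕ → ℝ≥0 → Ω → ℕ}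

lemma measurable_tilt_density (hN : ∀ i ∈ Finset.Icc 1 n, ∀ t, Measurable (N i t)) (θ : ℝ)
    (T : ℝ≥0) :
    Measurable fun ω => ENNReal.ofReal (Real.exp (θ * V N n T ω - (T : ℝ) * ell lam n θ)) :=
  (Real.measurable_exp.comp
    (((measurable_V hN T).const_mul θ).sub_const _)).ennreal_ofReal

lemma integrable_exp_V [IsProbabilityMeasure P]
    (hN : ∀ i ∈ Finset.Icc 1 n, IsPoissonProcess (N i) lam P)
    (hindep : iIndepFun (fun (i : Finset.Icc 1 n) ω t => N i t ω) P) (θ : ℝ) (t : ℝ≥0) :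
    Integrable (fun ω => Real.exp (θ * V N n t ω)) P ∧
      ∫ ω, Real.exp (θ * V N n t ω) ∂P = Real.exp (t * ell lam n θ) := by
  obtain ⟨h1, h2⟩ := (hasJointExponent_V hN hindep).real_exp_increment (ellC_ofReal lam n θ)
    (zero_le (a := t))
  have hae : (fun ω => Real.exp (θ * (V N n t ω - V N n 0 ω))) =ᵐ[P]
      fun ω => Real.exp (θ * V N n t ω) := by
    filter_upwards [ae_V_zero hN] with ω hω
    rw [hω, sub_zero]
  refine ⟨h1.congr hae, ?_⟩
  rw [← integral_congr_ae hae, h2, NNReal.coe_zero, sub_zero]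

lemma isProbabilityMeasure_tilt [IsProbabilityMeasure P]
    (hN : ∀ i ∈ Finset.Icc 1 n, IsPoissonProcess (N i) lam P)
    (hindep : iIndepFun (fun (i : Finset.Icc 1 n) ω t => N i t ω) P) (θ : ℝ) (T : ℝ≥0) :
    IsProbabilityMeasure (tilt P N lam n θ T) := by
  obtain ⟨h1, h2⟩ := integrable_exp_V hN hindep θ T
  constructor
  rw [tilt, withDensity_apply _ MeasurableSet.univ, Measure.restrict_univ]
  simp_rw [Real.exp_sub]
  rw [← ofReal_integral_eq_lintegral_ofReal (h1.div_const _)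
    (ae_of_all _ fun ω => by positivity), integral_div, h2, div_self (Real.exp_ne_zero _)]
  simp

lemma tilt_absolutelyContinuous (θ : ℝ) (T : ℝ≥0) : tilt P N lam n θ T ≪ P :=
  withDensity_absolutelyContinuous _ _

lemma absolutelyContinuous_tilt (hN : ∀ i ∈ Finset.Icc 1 n, ∀ t, Measurable (N i t)) (θ : ℝ)
    (T : ℝ≥0) : P ≪ tilt P N lam n θ T :=
  withDensity_absolutelyContinuous' (measurable_tilt_density hN θ T).aemeasurable
    (ae_of_all _ fun ω => by simp [Real.exp_pos])

lemma hasJointExponent_tilt [IsProbabilityMeasure P]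
    (hN : ∀ i ∈ Finset.Icc 1 n, IsPoissonProcess (N i) lam P)
    (hindep : iIndepFun (fun (i : Finset.Icc 1 n) ω t => N i t ω) P) (θ : ℝ) (T : ℝ≥0) :
    HasJointExponent T (V N n) (tilt P N lam n θ T)
      (fun z => ellC lam n (z + θ) - ellC lam n θ) :=
  (hasJointExponent_V hN hindep).esscher (measurable_V fun i hi => (hN i hi).measurable)
    (ae_V_zero hN) θ (ell lam n θ) (ellC_ofReal lam n θ) T

end Tilting

/-! ### Lévy measures on the positive integers -/

section LevyMeasure

variable {Ω : Type*} [MeasurableSpace Ω] {P : Measure Ω}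

lemma hasSum_cexp_of_nat [IsProbabilityMeasure P] {κ : Ω → ℕ} (hκ : Measurable κ) {φ : ℂ → ℂ}
    (h : ∀ z : ℂ, Integrable (fun ω => Complex.exp (z * κ ω)) P ∧
      ∫ ω, Complex.exp (z * κ ω) ∂P = Complex.exp (φ z)) (z : ℂ) :
    HasSum (fun k : ℕ => (P.real {ω | κ ω = k} : ℂ) * Complex.exp (z * k))
      (Complex.exp (φ z)) := by
  have hf : Measurable fun k : ℕ => Complex.exp (z * k) := measurable_from_nat
  have hsum : Measure.sum (fun k : ℕ => (P.map κ) {k} • Measure.dirac k) = P.map κ :=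
    Measure.sum_smul_dirac _
  have hint : Integrable (fun k : ℕ => Complex.exp (z * k)) (P.map κ) :=
    (integrable_map_measure hf.aestronglyMeasurable hκ.aemeasurable).2 (h z).1
  have hval : ∫ k : ℕ, Complex.exp (z * k) ∂(P.map κ) = Complex.exp (φ z) := by
    rw [integral_map hκ.aemeasurable hf.aestronglyMeasurable, (h z).2]
  rw [← hsum] at hint hval
  have key := hasSum_integral_measure hint
  rw [hval] at key
  refine key.congr_fun fun k => ?_
  rw [integral_smul_measure, integral_dirac, Measure.map_apply hκ (measurableSet_singleton k),
    Complex.real_smul]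
  rfl

/-- The Lévy–Khintchine data of a process with exponent
`lam (e^{φ(z + θ)} - e^{φ(θ)})`, where `e^φ` is the moment generating function of an `ℕ`-valued
variable `κ`: this is the exponent of a compound Poisson process whose jumps have the law of `κ`,
tilted by `θ`. Jumps of size `0` do not contribute. -/
lemma hasLevyMeasure_atomic [IsProbabilityMeasure P] {κ : Ω → ℕ} (hκ : Measurable κ) {φ : ℂ → ℂ}
    (h : ∀ z : ℂ, Integrable (fun ω => Complex.exp (z * κ ω)) P ∧
      ∫ ω, Complex.exp (z * κ ω) ∂P = Complex.exp (φ z))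
    {lam : ℝ≥0} {θ : ℝ} {T : ℝ≥0∞} {X : ℝ≥0 → Ω → ℝ} {Q : Measure Ω} (hX : IsLevyProcess T X Q)
    (hexp : HasExponent T X Q
      fun z => (lam : ℝ) * Complex.exp (φ (z + θ)) - (lam : ℝ) * Complex.exp (φ θ)) :
    HasLevyMeasure T X Q
      (atomicMeasure fun k => (lam : ℝ) * Real.exp (k * θ) * P.real {ω | κ ω = k}) := by
  set w : ℕ → ℝ := fun k => (lam : ℝ) * Real.exp (k * θ) * P.real {ω | κ ω = k} with hw
  have hw0 : ∀ k, 0 ≤ w k := fun k => by positivity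
  have hsum : ∀ z : ℂ, HasSum (fun k : ℕ => (w k : ℂ) * Complex.exp (z * k))
      ((lam : ℝ) * Complex.exp (φ (z + θ))) := by
    intro z
    refine ((hasSum_cexp_of_nat hκ h (z + θ)).mul_left ((lam : ℝ) : ℂ)).congr_fun fun k => ?_
    simp only [hw]
    push_cast
    rw [add_mul, Complex.exp_add, mul_comm (θ : ℂ)]
    ring
  have hsw : Summable w := by
    have := (hsum 0).summable
    simp only [zero_mul, Complex.exp_zero, mul_one] at this
    exact_mod_cast this
  -- the compensator `i u x 1_{|x| ≤ 1}` only sees the atom at `1`; the drift `w 1` cancels it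
  refine ⟨hX, ?_, ?_, w 1, 0, le_rfl, fun t ht u => ?_⟩
  · rw [atomicMeasure, Measure.sum_apply _ (measurableSet_singleton 0)]
    simp
  · refine lt_of_le_of_lt (lintegral_mono (g := fun _ => 1) fun x => ?_) ?_
    · exact ENNReal.ofReal_le_one.2 (min_le_left _ _)
    · rw [lintegral_one, atomicMeasure, Measure.sum_apply _ MeasurableSet.univ]
      simp only [Measure.smul_apply, measure_univ, smul_eq_mul, mul_one]
      exact (hsw.comp_injective PNat.coe_injective).tsum_ofReal_lt_top
  · have hJ : HasSum (fun k : ℕ => (w k : ℂ) * (Complex.exp (Complex.I * u * k) - 1 -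
          (if |(k : ℝ)| ≤ 1 then Complex.I * u * k else 0)))
        ((lam : ℝ) * Complex.exp (φ (Complex.I * u + θ)) - (lam : ℝ) * Complex.exp (φ θ) -
          w 1 * (Complex.I * u)) := by
      have h0 := hsum 0
      simp only [zero_mul, Complex.exp_zero, mul_one, zero_add] at h0
      have h1 : HasSum (fun k : ℕ => if k = 1 then (w 1 : ℂ) * (Complex.I * u) else 0)
          ((w 1 : ℂ) * (Complex.I * u)) := hasSum_ite_eq 1 _
      refine (((hsum (Complex.I * u)).sub h0).sub h1).congr_fun fun k => ?_
      rcases k with _ | _ | k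
      · simp
      · simp
        ring
      · have : ¬ |((k + 1 + 1 : ℕ) : ℝ)| ≤ 1 := by
          rw [Nat.abs_cast]
          push_cast
          have : (0 : ℝ) ≤ k := Nat.cast_nonneg k
          linarith
        rw [if_neg this, if_neg (by omega)]
        ring
    -- the term at `0` vanishes, so the sum may be taken over the positive integers
    have hJ' := (PNat.coe_injective.hasSum_iff fun k hk => by
      have : k = 0 := by
        by_contra hne
        exact hk ⟨⟨k, Nat.pos_of_ne_zero hne⟩, rfl⟩
      subst this
      simp).2 hJ
    have hint : ∫ x : ℝ, (Complex.exp (Complex.I * u * x) - 1 -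
          (if |x| ≤ 1 then Complex.I * u * x else 0)) ∂(atomicMeasure w) =
        (lam : ℝ) * Complex.exp (φ (Complex.I * u + θ)) - (lam : ℝ) * Complex.exp (φ θ) -
          w 1 * (Complex.I * u) := by
      rw [atomicMeasure, integral_sum_dirac fun _ => ENNReal.ofReal_ne_top, ← hJ'.tsum_eq]
      refine tsum_congr fun k => ?_
      rw [ENNReal.toReal_ofReal (hw0 _), Complex.real_smul]
      simp
    rw [(hexp t ht _).2, hint]
    congr 1
    push_cast
    ring

lemma exists_nat_V_one {m : ℕ} {N : ℕ → ℝ≥0 → Ω → ℕ}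
    (hN : ∀ i ∈ Finset.Icc 1 m, ∀ t, Measurable (N i t)) :
    ∃ κ : Ω → ℕ, Measurable κ ∧ ∀ ω, V N m 1 ω = κ ω := by
  refine ⟨fun ω => ⌊V N m 1 ω⌋₊, Nat.measurable_floor.comp (measurable_V hN 1), fun ω => ?_⟩
  rcases m with _ | m
  · simp [V, mipp]
  · simp [V, mipp]

end LevyMeasure

/-! ### Martingales from independent increments -/

section IndependentIncrements

variable {Ω : Type*} [mΩ : MeasurableSpace Ω] {P : Measure Ω} [IsProbabilityMeasure P]

lemma condExp_mul_of_indep {m : MeasurableSpace Ω} (hm : m ≤ mΩ) {A D : Ω → ℝ} {g : ℝ → ℝ}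
    (hA : StronglyMeasurable[m] A) (hD : Measurable[mΩ] D) (hg : Measurable g)
    (hind : Indep (MeasurableSpace.comap D inferInstance) m P)
    (hDi : Integrable (fun ω => g (D ω)) P) (hAD : Integrable (fun ω => A ω * g (D ω)) P) :
    P[fun ω => A ω * g (D ω) | m] =ᵐ[P] fun ω => A ω * ∫ ω, g (D ω) ∂P := by
  -- pull out `A`; the remaining conditional expectation is constant by independence
  have h1 : P[fun ω => A ω * g (D ω) | m] =ᵐ[P] A * P[fun ω => g (D ω) | m] :=
    condExp_mul_of_stronglyMeasurable_left hA hAD hDi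
  have h2 : P[fun ω => g (D ω) | m] =ᵐ[P] fun _ => ∫ ω, g (D ω) ∂P :=
    condExp_indep_eq hD.comap_le hm
      (hg.comp (comap_measurable D)).stronglyMeasurable hind
  filter_upwards [h1, h2] with ω hω1 hω2
  rw [hω1, Pi.mul_apply, hω2]

lemma condExp_of_indep {m : MeasurableSpace Ω} (hm : m ≤ mΩ) {D : Ω → ℝ} {g : ℝ → ℝ}
    (hD : Measurable[mΩ] D) (hg : Measurable g)
    (hind : Indep (MeasurableSpace.comap D inferInstance) m P) :
    P[fun ω => g (D ω) | m] =ᵐ[P] fun _ => ∫ ω, g (D ω) ∂P :=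
  condExp_indep_eq hD.comap_le hm (hg.comp (comap_measurable D)).stronglyMeasurable hind

variable {ℱ : Filtration ℝ≥0 mΩ} {X : ℝ≥0 → Ω → ℝ}

lemma martingale_of_indep_increments (hX : StronglyAdapted ℱ X) (hint : ∀ t, Integrable (X t) P)
    (hind : ∀ s t, s ≤ t → Indep (MeasurableSpace.comap (fun ω => X t ω - X s ω) inferInstance)
      (ℱ s) P)
    (hmean : ∀ s t, s ≤ t → ∫ ω, (X t ω - X s ω) ∂P = 0) : Martingale X ℱ P := by
  refine ⟨hX, fun s t hst => ?_⟩
  have hXm : ∀ t, Measurable (X t) := fun t => ((hX t).mono (ℱ.le t)).measurable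
  have hD : Measurable fun ω => X t ω - X s ω := (hXm t).sub (hXm s)
  have h1 := condExp_of_indep (ℱ.le s) hD measurable_id (hind s t hst)
  have h2 : P[X s | ℱ s] = X s := condExp_of_stronglyMeasurable (ℱ.le s) (hX s) (hint s)
  have h3 : X t = X s + fun ω => X t ω - X s ω := by funext ω; simp
  have h4 : P[X t | ℱ s] =ᵐ[P] P[X s | ℱ s] + P[fun ω => X t ω - X s ω | ℱ s] := by
    conv_lhs => rw [h3]
    exact condExp_add (hint s) ((hint t).sub (hint s)) _
  filter_upwards [h1, h4] with ω hω1 hω4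
  rw [hω4, Pi.add_apply, h2, add_eq_left]
  exact hω1.trans (hmean s t hst)

lemma martingale_sq_of_indep_increments (hX : StronglyAdapted ℱ X) (hL : ∀ t, MemLp (X t) 2 P)
    (hind : ∀ s t, s ≤ t → Indep (MeasurableSpace.comap (fun ω => X t ω - X s ω) inferInstance)
      (ℱ s) P)
    (hmean : ∀ s t, s ≤ t → ∫ ω, (X t ω - X s ω) ∂P = 0) {c : ℝ}
    (hvar : ∀ s t : ℝ≥0, s ≤ t → ∫ ω, (X t ω - X s ω) ^ 2 ∂P = c * (t - s)) :
    Martingale (fun (t : ℝ≥0) ω => X t ω ^ 2 - c * t) ℱ P := by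
  have hadapt : ∀ t : ℝ≥0, StronglyMeasurable[ℱ t] fun ω => X t ω ^ 2 - c * t := fun t =>
    ((hX t).pow 2).sub stronglyMeasurable_const
  have hint : ∀ t : ℝ≥0, Integrable (fun ω => X t ω ^ 2 - c * t) P := fun t =>
    (hL t).integrable_sq.sub (integrable_const _)
  refine ⟨hadapt, fun s t hst => ?_⟩
  have hXm : ∀ t, Measurable (X t) := fun t => ((hX t).mono (ℱ.le t)).measurable
  have hD : Measurable fun ω => X t ω - X s ω := (hXm t).sub (hXm s)
  have hDL : MemLp (fun ω => X t ω - X s ω) 2 P := (hL t).sub (hL s)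
  have hmulint : Integrable (fun ω => 2 * X s ω * (X t ω - X s ω)) P := by
    refine (((hL s).integrable_mul hDL).const_mul 2).congr (ae_of_all _ fun ω => ?_)
    simp only [Pi.mul_apply]
    ring
  have h1 := condExp_mul_of_indep (g := id) (ℱ.le s) ((hX s).const_mul 2) hD measurable_id
    (hind s t hst) (hDL.integrable one_le_two) hmulint
  have h1' := condExp_of_indep (ℱ.le s) hD (g := fun x => x ^ 2 - c * (t - s)) (by fun_prop)
    (hind s t hst)
  have h2 : P[fun ω => X s ω ^ 2 - c * s | ℱ s] = fun ω => X s ω ^ 2 - c * s :=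
    condExp_of_stronglyMeasurable (ℱ.le s) (hadapt s) (hint s)
  have hsq : Integrable (fun ω => (X t ω - X s ω) ^ 2 - c * (t - s)) P :=
    hDL.integrable_sq.sub (integrable_const _)
  have h3 : (fun ω => X t ω ^ 2 - c * t) = (fun ω => X s ω ^ 2 - c * s) +
      ((fun ω => 2 * X s ω * (X t ω - X s ω)) +
        fun ω => (X t ω - X s ω) ^ 2 - c * (t - s)) := by
    funext ω
    simp only [Pi.add_apply]
    ring
  have h4 := condExp_add (hint s) (hmulint.add hsq) (ℱ s)
  have h5 := condExp_add hmulint hsq (ℱ s)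
  have hmean' : ∫ ω, id (X t ω - X s ω) ∂P = 0 := hmean s t hst
  have hvar' : ∫ ω, ((X t ω - X s ω) ^ 2 - c * (t - s)) ∂P = 0 := by
    rw [integral_sub hDL.integrable_sq (integrable_const _), hvar s t hst]
    simp
  simp only [h3]
  filter_upwards [h1, h1', h4, h5] with ω hω1 hω1' hω4 hω5
  rw [hω4, Pi.add_apply, hω5, Pi.add_apply, h2]
  rw [hmean', mul_zero] at hω1
  rw [hvar'] at hω1'
  simp only [id] at hω1
  rw [hω1, hω1']
  simp

lemma martingale_exp_of_indep_increments (hX : StronglyAdapted ℱ X) {θ c : ℝ}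
    (hint : ∀ t, Integrable (fun ω => Real.exp (θ * X t ω)) P)
    (hind : ∀ s t, s ≤ t → Indep (MeasurableSpace.comap (fun ω => X t ω - X s ω) inferInstance)
      (ℱ s) P)
    (hexp : ∀ s t : ℝ≥0, s ≤ t → Integrable (fun ω => Real.exp (θ * (X t ω - X s ω))) P ∧
      ∫ ω, Real.exp (θ * (X t ω - X s ω)) ∂P = Real.exp ((t - s) * c)) :
    Martingale (fun (t : ℝ≥0) ω => Real.exp (θ * X t ω - t * c)) ℱ P := by
  have hadapt : ∀ t : ℝ≥0, StronglyMeasurable[ℱ t] fun ω => Real.exp (θ * X t ω - t * c) :=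
    fun t => Real.continuous_exp.comp_stronglyMeasurable
      (((hX t).const_mul θ).sub stronglyMeasurable_const)
  have hint' : ∀ t : ℝ≥0, Integrable (fun ω => Real.exp (θ * X t ω - t * c)) P := fun t => by
    simp_rw [Real.exp_sub]
    exact (hint t).div_const _
  refine ⟨hadapt, fun s t hst => ?_⟩
  have hXm : ∀ t, Measurable (X t) := fun t => ((hX t).mono (ℱ.le t)).measurable
  have hD : Measurable fun ω => X t ω - X s ω := (hXm t).sub (hXm s)
  have h3 : (fun ω => Real.exp (θ * X t ω - t * c)) = fun ω =>
      Real.exp (θ * X s ω - s * c) * Real.exp (θ * (X t ω - X s ω) - (t - s) * c) := by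
    funext ω
    rw [← Real.exp_add]
    congr 1
    ring
  obtain ⟨he1, he2⟩ := hexp s t hst
  have h1 := condExp_mul_of_indep (g := fun x => Real.exp (θ * x - (t - s) * c)) (ℱ.le s)
    (hadapt s) hD (by fun_prop) (hind s t hst)
    (by simp_rw [Real.exp_sub]; exact he1.div_const _) (by rw [← h3]; exact hint' t)
  have h2 : ∫ ω, Real.exp (θ * (X t ω - X s ω) - (t - s) * c) ∂P = 1 := by
    simp_rw [Real.exp_sub]
    rw [integral_div, he2, div_self (Real.exp_ne_zero _)]
  simp only [h2, mul_one] at h1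
  rw [← h3] at h1
  exact h1

end IndependentIncrements

/-! ### Moments -/

section Moments

lemma geomRatio_succ (x : ℝ) (m : ℕ) : geomRatio x (m + 1) = x ^ m + geomRatio x m := by
  unfold geomRatio
  split_ifs with h
  · subst h
    push_cast
    ring
  · have : 1 - x ≠ 0 := sub_ne_zero.2 (Ne.symm h)
    field_simp
    ring

lemma ell_zero (lam : ℝ≥0) (n : ℕ) : ell lam n 0 = 0 := by
  induction n with
  | zero => rfl
  | succ m ih => rw [ell, ih]; simp

/-- First and second derivative at `0` of the exponent `ℓ_n`. -/
lemma exists_hasDerivAt_ell (lam : ℝ≥0) (n : ℕ) :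
    ∃ d : ℝ → ℝ, (∀ θ, HasDerivAt (ell lam n) (d θ) θ) ∧ d 0 = (lam : ℝ) ^ n ∧
      HasDerivAt d (geomRatio lam n * (lam : ℝ) ^ n) 0 := by
  induction n with
  | zero =>
    refine ⟨fun _ => 1, fun θ => hasDerivAt_id θ, by simp, ?_⟩
    have : geomRatio lam 0 = 0 := by simp [geomRatio]
    simpa [this] using hasDerivAt_const (0 : ℝ) (1 : ℝ)
  | succ m ih =>
    obtain ⟨d, hd, hd0, hdd⟩ := ih
    have he : ∀ θ, HasDerivAt (fun x => (lam : ℝ) * Real.exp (ell lam m x))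
        (lam * (Real.exp (ell lam m θ) * d θ)) θ := fun θ => ((hd θ).exp).const_mul _
    refine ⟨fun θ => lam * (Real.exp (ell lam m θ) * d θ), fun θ => (he θ).sub_const _, ?_, ?_⟩
    · simp only [ell_zero, hd0, Real.exp_zero, pow_succ]
      ring
    · refine (((hd 0).exp.mul hdd).const_mul (lam : ℝ)).congr_deriv ?_
      rw [ell_zero, hd0, Real.exp_zero, geomRatio_succ]
      ring

/-- A variable whose moment generating function is `exp (h f(θ))` with `f 0 = 0` has mean
`h f'(0)` and second moment `h f''(0) + (h f'(0))²`. -/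
lemma moments_of_mgf {Ω : Type*} [MeasurableSpace Ω] {P : Measure Ω} {D : Ω → ℝ} {h : ℝ}
    {f d : ℝ → ℝ} {e : ℝ} (hD : ∀ θ, Integrable (fun ω => Real.exp (θ * D ω)) P ∧
      ∫ ω, Real.exp (θ * D ω) ∂P = Real.exp (h * f θ))
    (hf0 : f 0 = 0) (hf : ∀ θ, HasDerivAt f (d θ) θ) (hd : HasDerivAt d e 0) :
    MemLp D 2 P ∧ ∫ ω, D ω ∂P = h * d 0 ∧ ∫ ω, D ω ^ 2 ∂P = h * e + (h * d 0) ^ 2 := by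
  have huniv : integrableExpSet D P = Set.univ := Set.eq_univ_of_forall fun θ => (hD θ).1
  have hin : (0 : ℝ) ∈ interior (integrableExpSet D P) := by simp [huniv]
  have hmgf : mgf D P = fun θ => Real.exp (h * f θ) := funext fun θ => (hD θ).2
  have hder : ∀ θ, HasDerivAt (mgf D P) (Real.exp (h * f θ) * (h * d θ)) θ := fun θ => by
    rw [hmgf]
    exact ((hf θ).const_mul h).exp
  have hderiv : iteratedDeriv 1 (mgf D P) = fun θ => Real.exp (h * f θ) * (h * d θ) := by
    rw [iteratedDeriv_one]
    exact funext fun θ => (hder θ).deriv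
  have h1 := (hder 0).deriv.symm.trans (deriv_mgf_zero hin)
  have h2 := hasDerivAt_iteratedDeriv_mgf hin 1
  rw [hderiv] at h2
  have h2' := h2.unique (((hf 0).const_mul h).exp.mul (hd.const_mul h))
  refine ⟨memLp_of_mem_interior_integrableExpSet hin 2, ?_, ?_⟩
  · rw [← h1, hf0]
    simp
  · have : ∫ ω, D ω ^ 2 ∂P = ∫ ω, D ω ^ (1 + 1) * Real.exp (0 * D ω) ∂P := by simp
    rw [this, h2', hf0]
    simp
    ring

end Moments

/-! ### The martingales of the iterated process -/

section Martingales

lemma M_increment {Ω : Type*} {N : ℕ → ℝ≥0 → Ω → ℕ} {lam : ℝ≥0} {n : ℕ} (s t : ℝ≥0) (ω : Ω) :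
    M N lam n t ω - M N lam n s ω = V N n t ω - V N n s ω - (t - s) * (lam : ℝ) ^ n := by
  unfold M
  ring

variable {Ω : Type*} [mΩ : MeasurableSpace Ω] {P : Measure Ω} [IsProbabilityMeasure P]
  {lam : ℝ≥0} {n : ℕ} {N : ℕ → ℝ≥0 → Ω → ℕ}

lemma hasIndepIncrements_V (hN : ∀ i ∈ Finset.Icc 1 n, IsPoissonProcess (N i) lam P)
    (hindep : iIndepFun (fun (i : Finset.Icc 1 n) ω t => N i t ω) P) :
    HasIndepIncrements (V N n) P := fun k t ht =>
  (hasJointExponent_V hN hindep).hasIndepIncrements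
    (fun t _ => measurable_V (fun i hi => (hN i hi).measurable) t) k (fun i => ⟨t i, le_top⟩) ht

lemma stronglyAdapted_V (hN : ∀ i ∈ Finset.Icc 1 n, ∀ t, Measurable (N i t)) :
    StronglyAdapted (mippFiltration N n hN) (V N n) := fun t =>
  NNReal.continuous_coe.comp_stronglyMeasurable
    (Filtration.stronglyAdapted_natural (fun t => (measurable_mipp hN t).stronglyMeasurable) t)

lemma indep_increment_mippFiltration
    (hN : ∀ i ∈ Finset.Icc 1 n, IsPoissonProcess (N i) lam P)
    (hindep : iIndepFun (fun (i : Finset.Icc 1 n) ω t => N i t ω) P) {s t : ℝ≥0} (hst : s ≤ t) :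
    Indep (MeasurableSpace.comap (fun ω => V N n t ω - V N n s ω) inferInstance)
      (mippFiltration N n (fun i hi => (hN i hi).measurable) s) P := by
  have h := (indepFun_increment_past (measurable_V fun i hi => (hN i hi).measurable)
    (ae_V_zero hN) (hasIndepIncrements_V hN hindep) hst).comp (φ := id)
    (ψ := fun (p : Set.Iic s → ℝ) j => Real.toNNReal (p j)) measurable_id
    (measurable_pi_lambda _ fun j => measurable_real_toNNReal.comp (measurable_pi_apply j))
  have hcomp : ((fun (p : Set.Iic s → ℝ) j => Real.toNNReal (p j)) ∘
      fun ω (j : Set.Iic s) => V N n j ω) = fun ω (j : Set.Iic s) => mipp N n j ω := by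
    funext ω j
    simp [V]
  rw [hcomp] at h
  rw [mippFiltration, Filtration.natural_eq_comap]
  exact h

lemma moments_increment_V (hN : ∀ i ∈ Finset.Icc 1 n, IsPoissonProcess (N i) lam P)
    (hindep : iIndepFun (fun (i : Finset.Icc 1 n) ω t => N i t ω) P) {s t : ℝ≥0} (hst : s ≤ t) :
    MemLp (fun ω => V N n t ω - V N n s ω) 2 P ∧
      ∫ ω, (V N n t ω - V N n s ω) ∂P = (t - s) * (lam : ℝ) ^ n ∧
      ∫ ω, (V N n t ω - V N n s ω) ^ 2 ∂P =
        (t - s) * (geomRatio lam n * (lam : ℝ) ^ n) + ((t - s) * (lam : ℝ) ^ n) ^ 2 := by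
  obtain ⟨d, hd, hd0, hdd⟩ := exists_hasDerivAt_ell lam n
  rw [← hd0]
  refine moments_of_mgf (fun θ => ?_) (ell_zero lam n) hd (hd0 ▸ hdd)
  exact (hasJointExponent_V hN hindep).real_exp_increment (ellC_ofReal lam n θ) hst

lemma moments_V (hN : ∀ i ∈ Finset.Icc 1 n, IsPoissonProcess (N i) lam P)
    (hindep : iIndepFun (fun (i : Finset.Icc 1 n) ω t => N i t ω) P) (t : ℝ≥0) :
    MemLp (V N n t) 2 P ∧ ∫ ω, V N n t ω ∂P = (lam : ℝ) ^ n * t := by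
  obtain ⟨h1, h2, -⟩ := moments_increment_V hN hindep (zero_le (a := t))
  have hae : (fun ω => V N n t ω - V N n 0 ω) =ᵐ[P] V N n t := by
    filter_upwards [ae_V_zero hN] with ω hω
    rw [hω, sub_zero]
  refine ⟨(memLp_congr_ae hae).1 h1, ?_⟩
  rw [← integral_congr_ae hae, h2, NNReal.coe_zero, sub_zero, mul_comm]

lemma stronglyAdapted_M (hN : ∀ i ∈ Finset.Icc 1 n, ∀ t, Measurable (N i t)) :
    StronglyAdapted (mippFiltration N n hN) (M N lam n) := fun t =>
  (stronglyAdapted_V hN t).sub stronglyMeasurable_const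

lemma memLp_M (hN : ∀ i ∈ Finset.Icc 1 n, IsPoissonProcess (N i) lam P)
    (hindep : iIndepFun (fun (i : Finset.Icc 1 n) ω t => N i t ω) P) (t : ℝ≥0) :
    MemLp (M N lam n t) 2 P :=
  (moments_V hN hindep t).1.sub (memLp_const _)

lemma indep_increment_M (hN : ∀ i ∈ Finset.Icc 1 n, IsPoissonProcess (N i) lam P)
    (hindep : iIndepFun (fun (i : Finset.Icc 1 n) ω t => N i t ω) P) {s t : ℝ≥0} (hst : s ≤ t) :
    Indep (MeasurableSpace.comap (fun ω => M N lam n t ω - M N lam n s ω) inferInstance)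
      (mippFiltration N n (fun i hi => (hN i hi).measurable) s) P := by
  refine indep_of_indep_of_le_left (indep_increment_mippFiltration hN hindep hst) ?_
  simp_rw [M_increment]
  exact ((comap_measurable fun ω => V N n t ω - V N n s ω).sub_const _).comap_le

lemma integral_increment_M (hN : ∀ i ∈ Finset.Icc 1 n, IsPoissonProcess (N i) lam P)
    (hindep : iIndepFun (fun (i : Finset.Icc 1 n) ω t => N i t ω) P) {s t : ℝ≥0} (hst : s ≤ t) :
    ∫ ω, (M N lam n t ω - M N lam n s ω) ∂P = 0 := by
  obtain ⟨h1, h2, -⟩ := moments_increment_V hN hindep hst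
  simp_rw [M_increment]
  rw [integral_sub (h1.integrable one_le_two) (integrable_const _), h2]
  simp

lemma integral_increment_M_sq (hN : ∀ i ∈ Finset.Icc 1 n, IsPoissonProcess (N i) lam P)
    (hindep : iIndepFun (fun (i : Finset.Icc 1 n) ω t => N i t ω) P) {s t : ℝ≥0} (hst : s ≤ t) :
    ∫ ω, (M N lam n t ω - M N lam n s ω) ^ 2 ∂P = geomRatio lam n * (lam : ℝ) ^ n * (t - s) := by
  obtain ⟨h1, h2, h3⟩ := moments_increment_V hN hindep hst
  have hexp : ∀ ω, (M N lam n t ω - M N lam n s ω) ^ 2 = (V N n t ω - V N n s ω) ^ 2 -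
      2 * ((t - s) * (lam : ℝ) ^ n) * (V N n t ω - V N n s ω) + ((t - s) * (lam : ℝ) ^ n) ^ 2 :=
    fun ω => by
      rw [M_increment]
      ring
  simp_rw [hexp]
  have hi := (h1.integrable one_le_two).const_mul (2 * (((t : ℝ) - s) * (lam : ℝ) ^ n))
  have hsub : Integrable (fun ω => (V N n t ω - V N n s ω) ^ 2 -
      2 * ((t - s) * (lam : ℝ) ^ n) * (V N n t ω - V N n s ω)) P := h1.integrable_sq.sub hi
  rw [integral_add hsub (integrable_const _),
    integral_sub h1.integrable_sq hi, integral_const_mul, h2, h3]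
  simp
  ring

lemma martingale_exp_V (hN : ∀ i ∈ Finset.Icc 1 n, IsPoissonProcess (N i) lam P)
    (hindep : iIndepFun (fun (i : Finset.Icc 1 n) ω t => N i t ω) P) (θ : ℝ) :
    Martingale (fun (t : ℝ≥0) ω => Real.exp (θ * V N n t ω - (t : ℝ) * ell lam n θ))
      (mippFiltration N n fun i hi => (hN i hi).measurable) P :=
  martingale_exp_of_indep_increments (stronglyAdapted_V _)
    (fun t => (integrable_exp_V hN hindep θ t).1)
    (fun _ _ hst => indep_increment_mippFiltration hN hindep hst)
    fun _ _ hst => (hasJointExponent_V hN hindep).real_exp_increment (ellC_ofReal lam n θ) hst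

/-- Consistency of the tilted measures: the density processes are martingales. -/
lemma tilt_apply_eq_of_le (hN : ∀ i ∈ Finset.Icc 1 n, IsPoissonProcess (N i) lam P)
    (hindep : iIndepFun (fun (i : Finset.Icc 1 n) ω t => N i t ω) P) (θ : ℝ) {s T : ℝ≥0}
    (hsT : s ≤ T) {A : Set Ω}
    (hA : MeasurableSet[mippFiltration N n (fun i hi => (hN i hi).measurable) s] A) :
    tilt P N lam n θ T A = tilt P N lam n θ s A := by
  have hmart := martingale_exp_V hN hindep θ
  have hA' : MeasurableSet A := Filtration.le _ s A hA
  rw [tilt, tilt, withDensity_apply _ hA', withDensity_apply _ hA',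
    ← ofReal_integral_eq_lintegral_ofReal (hmart.integrable T).integrableOn
      (ae_of_all _ fun ω => Real.exp_nonneg _),
    ← ofReal_integral_eq_lintegral_ofReal (hmart.integrable s).integrableOn
      (ae_of_all _ fun ω => Real.exp_nonneg _), hmart.setIntegral_eq hsT hA]

end Martingales

/-! ### The compound Poisson representation -/

section CompoundPoisson

variable {Ω : Type*} [MeasurableSpace Ω] {P : Measure Ω} [IsProbabilityMeasure P]
  {lam : ℝ≥0} {N : ℕ → ℝ≥0 → Ω → ℕ}

lemma map_increment_eq_of_hasJointExponent {X Y : ℝ≥0 → Ω → ℝ} {ψ : ℂ → ℂ}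
    (hX : HasJointExponent ∞ X P ψ) (hY : HasJointExponent ∞ Y P ψ)
    (hXm : ∀ t, Measurable (X t)) (hYm : ∀ t, Measurable (Y t)) {s t s' t' : ℝ≥0} (hst : s ≤ t)
    (hst' : s' ≤ t') (heq : (t : ℝ) - s = t' - s') :
    P.map (fun ω => X t ω - X s ω) = P.map (fun ω => Y t' ω - Y s' ω) := by
  have := Measure.isProbabilityMeasure_map (μ := P) ((hXm t).sub (hXm s)).aemeasurable
  have := Measure.isProbabilityMeasure_map (μ := P) ((hYm t').sub (hYm s')).aemeasurable
  refine Measure.ext_of_charFun ?_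
  ext r
  rw [hX.charFun_increment (fun t _ => hXm t) hst le_top,
    hY.charFun_increment (fun t _ => hYm t) hst' le_top, heq]

lemma forall_castSucc {p : ℕ → Prop} {m : ℕ} (h : ∀ i ∈ Finset.Icc 1 (m + 1), p i) :
    ∀ i ∈ Finset.Icc 1 m, p i := fun i hi =>
  h i (by simp only [Finset.mem_Icc] at hi ⊢; omega)

omit [IsProbabilityMeasure P] in
lemma iIndepFun_castSucc {m : ℕ}
    (h : iIndepFun (fun (i : Finset.Icc 1 (m + 1)) ω t => N i t ω) P) :
    iIndepFun (fun (i : Finset.Icc 1 m) ω t => N i t ω) P :=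
  h.precomp (Set.inclusion_injective
    (show (Finset.Icc 1 m : Set ℕ) ⊆ Finset.Icc 1 (m + 1) by
      intro i hi
      simp only [Finset.coe_Icc, Set.mem_Icc] at hi ⊢
      omega))

/-- The jumps of `V⁽ᵐ⁺¹⁾` are the increments over the intervals `[i, i + 1]` of the `m`-fold
iteration of `N², N³, …`. -/
lemma isJumpSequence_increments {m : ℕ}
    (hN : ∀ i ∈ Finset.Icc 1 (m + 1), IsPoissonProcess (N i) lam P)
    (hindep : iIndepFun (fun (i : Finset.Icc 1 (m + 1)) ω t => N i t ω) P) :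
    IsJumpSequence (fun i ω => mipp (fun j => N (j + 1)) m ((i + 1 : ℕ) : ℝ≥0) ω -
      mipp (fun j => N (j + 1)) m (i : ℝ≥0) ω) N m P := by
  have hs := forall_shift hN
  have hsm := fun i hi => (hs i hi).measurable
  have hJs := hasJointExponent_V hs (iIndepFun_shift hindep)
  have hc := forall_castSucc hN
  have hJc := hasJointExponent_V hc (iIndepFun_castSucc hindep)
  have hVm := measurable_V hsm
  have hVcm := measurable_V fun i hi => (hc i hi).measurable
  -- the subtraction in `ℝ≥0` is `Real.toNNReal` of the real increment of a nondecreasing process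
  have hm : ∀ i : ℕ, Measurable fun ω => mipp (fun j => N (j + 1)) m ((i + 1 : ℕ) : ℝ≥0) ω -
      mipp (fun j => N (j + 1)) m (i : ℝ≥0) ω := fun i =>
    (measurable_mipp hsm _).sub (measurable_mipp hsm _)
  refine ⟨hm, ?_, fun i => ⟨(hm i).aemeasurable,
    (measurable_mipp (fun i hi => (hc i hi).measurable) 1).aemeasurable, ?_⟩, ?_⟩
  · have h := (hasIndepIncrements_V hs (iIndepFun_shift hindep)).nat
      (t := fun i : ℕ => (i : ℝ≥0)) Nat.mono_cast
    exact h.comp (fun _ => Real.toNNReal) fun _ => measurable_real_toNNReal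
  · have h1 := map_increment_eq_of_hasJointExponent hJs hJc hVm hVcm
      (s := (i : ℝ≥0)) (t := ((i + 1 : ℕ) : ℝ≥0)) (s' := 0) (t' := 1)
      (Nat.mono_cast (Nat.le_succ i)) zero_le (by push_cast; ring)
    have h2 : (fun ω => V N m 1 ω - V N m 0 ω) =ᵐ[P] V N m 1 := by
      filter_upwards [ae_V_zero hc] with ω hω
      rw [hω, sub_zero]
    rw [Measure.map_congr h2] at h1
    have h3 := congrArg (fun μ => μ.map Real.toNNReal) h1
    have hD : Measurable fun ω => V (fun j => N (j + 1)) m ((i + 1 : ℕ) : ℝ≥0) ω -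
        V (fun j => N (j + 1)) m (i : ℝ≥0) ω := (hVm _).sub (hVm _)
    rw [Measure.map_map measurable_real_toNNReal hD,
      Measure.map_map measurable_real_toNNReal (hVcm 1)] at h3
    have h4 : Real.toNNReal ∘ V N m 1 = mipp N m 1 := by
      funext ω
      simp [V]
    rw [h4] at h3
    exact h3
  · exact ((indepFun_fst_shift (fun i hi => (hN i hi).measurable) hindep).comp (φ := id)
      (ψ := fun (p : ℝ≥0 → ℝ≥0) (i : ℕ) => p ((i + 1 : ℕ) : ℝ≥0) - p (i : ℝ≥0)) measurable_id
      (measurable_pi_lambda _ fun i =>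
        (measurable_pi_apply _).sub (measurable_pi_apply _))).symm

omit [IsProbabilityMeasure P] in
/-- Almost surely, `V⁽ᵐ⁺¹⁾` is the sum of its jumps, at all times simultaneously. -/
lemma ae_mipp_eq_sum_jumps {m : ℕ}
    (hN : ∀ i ∈ Finset.Icc 1 (m + 1), IsPoissonProcess (N i) lam P) :
    ∀ᵐ ω ∂P, ∀ t, mipp N (m + 1) t ω = ∑ i ∈ Finset.range (N 1 t ω),
      (mipp (fun j => N (j + 1)) m ((i + 1 : ℕ) : ℝ≥0) ω -
        mipp (fun j => N (j + 1)) m (i : ℝ≥0) ω) := by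
  have hs := forall_shift hN
  filter_upwards [ae_path_mipp hs, ae_V_zero hs] with ω h1 h0 t
  have h0' : mipp (fun j => N (j + 1)) m 0 ω = 0 := NNReal.coe_eq_zero.1 h0
  have hmono : Monotone fun k : ℕ => mipp (fun j => N (j + 1)) m (k : ℝ≥0) ω :=
    h1.1.comp Nat.mono_cast
  rw [mipp_succ_eq_shift, Finset.sum_range_tsub hmono, Nat.cast_zero, h0', tsub_zero]

omit [IsProbabilityMeasure P] in
lemma measurable_fst_process {m : ℕ}
    (hN : ∀ i ∈ Finset.Icc 1 (m + 1), IsPoissonProcess (N i) lam P) :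
    Measurable fun ω t => N 1 t ω :=
  measurable_pi_lambda _ fun t => (hN 1 (by simp)).measurable t

omit [IsProbabilityMeasure P] in
lemma measurable_compound_sum :
    Measurable fun (p : (ℝ≥0 → ℕ) × (ℕ → ℝ≥0)) (t : ℝ≥0) => ∑ i ∈ Finset.range (p.1 t), p.2 i := by
  have hk : Measurable fun q : ℕ × (ℕ → ℝ≥0) => ∑ i ∈ Finset.range q.1, q.2 i :=
    measurable_from_prod_countable_right fun k =>
      Finset.measurable_fun_sum (f := fun (i : ℕ) (y : ℕ → ℝ≥0) => y i) (Finset.range k)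
        fun i _ => measurable_pi_apply i
  exact measurable_pi_lambda _ fun t => hk.comp
    (f := fun p : (ℝ≥0 → ℕ) × (ℕ → ℝ≥0) => (p.1 t, p.2))
    (((measurable_pi_apply t).comp measurable_fst).prodMk measurable_snd)

/-- The joint law of `N¹` and a jump sequence is a product measure, the same for all jump
sequences. -/
lemma IsJumpSequence.map_prod_eq {m : ℕ} {Y Y' : ℕ → Ω → ℝ≥0} (hY : IsJumpSequence Y N m P)
    (hY' : IsJumpSequence Y' N m P) (hN1 : Measurable fun ω t => N 1 t ω) :
    P.map (fun ω => ((fun t => N 1 t ω), fun i => Y i ω)) =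
      P.map (fun ω => ((fun t => N 1 t ω), fun i => Y' i ω)) := by
  have hm : ∀ {Y : ℕ → Ω → ℝ≥0}, IsJumpSequence Y N m P →
      P.map (fun ω => ((fun t => N 1 t ω), fun i => Y i ω)) =
      (P.map fun ω t => N 1 t ω).prod (Measure.infinitePi fun _ : ℕ => P.map (mipp N m 1)) := by
    intro Y hY
    rw [hY.indep_fst.symm.map_prod_eq_prod_map_map hN1.aemeasurable
      (measurable_pi_lambda _ hY.measurable).aemeasurable,
      hY.iIndep.map_fun_eq_infinitePi_map hY.measurable]
    simp_rw [fun i => (hY.identDistrib i).map_eq]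
  rw [hm hY, hm hY']

lemma identDistrib_mipp_compound {m : ℕ}
    (hN : ∀ i ∈ Finset.Icc 1 (m + 1), IsPoissonProcess (N i) lam P)
    (hindep : iIndepFun (fun (i : Finset.Icc 1 (m + 1)) ω t => N i t ω) P) {Y : ℕ → Ω → ℝ≥0}
    (hY : IsJumpSequence Y N m P) :
    IdentDistrib (fun ω t => mipp N (m + 1) t ω)
      (fun ω (t : ℝ≥0) => ∑ i ∈ Finset.range (N 1 t ω), Y i ω) P P := by
  have hN1 := measurable_fst_process hN
  have hY0 := isJumpSequence_increments hN hindep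
  have hpair : ∀ {Y : ℕ → Ω → ℝ≥0}, IsJumpSequence Y N m P →
      Measurable fun ω => ((fun t => N 1 t ω), fun i => Y i ω) := fun hY =>
    hN1.prodMk (measurable_pi_lambda _ hY.measurable)
  refine ⟨(measurable_pi_lambda _ fun t =>
    measurable_mipp (fun i hi => (hN i hi).measurable) t).aemeasurable,
    (measurable_compound_sum.comp (hpair hY)).aemeasurable, ?_⟩
  have hae : (fun ω t => mipp N (m + 1) t ω) =ᵐ[P]
      (fun (p : (ℝ≥0 → ℕ) × (ℕ → ℝ≥0)) (t : ℝ≥0) => ∑ i ∈ Finset.range (p.1 t), p.2 i) ∘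
        fun ω => ((fun t => N 1 t ω), fun i => mipp (fun j => N (j + 1)) m ((i + 1 : ℕ) : ℝ≥0) ω -
          mipp (fun j => N (j + 1)) m (i : ℝ≥0) ω) := by
    filter_upwards [ae_mipp_eq_sum_jumps hN] with ω hω
    exact funext hω
  rw [Measure.map_congr hae, ← Measure.map_map measurable_compound_sum (hpair hY0),
    hY0.map_prod_eq hY hN1, Measure.map_map measurable_compound_sum (hpair hY)]
  rfl

end CompoundPoisson

/-! ### The law of large numbers -/

section LawOfLargeNumbers

/-- For monotone `f`, convergence of `f t / t` along the integers gives convergence along all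
real `t → ∞`. -/
lemma tendsto_div_of_monotone_of_nat {f : ℝ≥0 → ℝ} (hf : Monotone f) {c : ℝ}
    (h : Tendsto (fun k : ℕ => f k / k) atTop (𝓝 c)) :
    Tendsto (fun t : ℝ≥0 => f t / (t : ℝ)) atTop (𝓝 c) := by
  have hcoe : Tendsto (fun t : ℝ≥0 => (t : ℝ)) atTop atTop := NNReal.tendsto_coe_atTop.2 tendsto_id
  have hlow : Tendsto (fun t : ℝ≥0 => f ⌊(t : ℝ)⌋₊ / ⌊(t : ℝ)⌋₊ * (⌊(t : ℝ)⌋₊ / (t : ℝ))) atTop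
      (𝓝 c) := by
    simpa using (h.comp (tendsto_nat_floor_atTop.comp hcoe)).mul
      ((tendsto_nat_floor_div_atTop (R := ℝ)).comp hcoe)
  have hupp : Tendsto (fun t : ℝ≥0 => f ⌈(t : ℝ)⌉₊ / ⌈(t : ℝ)⌉₊ * (⌈(t : ℝ)⌉₊ / (t : ℝ))) atTop
      (𝓝 c) := by
    simpa using (h.comp (tendsto_nat_ceil_atTop.comp hcoe)).mul
      ((tendsto_nat_ceil_div_atTop (R := ℝ)).comp hcoe)
  refine tendsto_of_tendsto_of_tendsto_of_le_of_le' hlow hupp ?_ ?_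
  · filter_upwards [eventually_ge_atTop 1] with t ht
    have ht' : (1 : ℝ) ≤ t := by exact_mod_cast ht
    have hpos : (⌊(t : ℝ)⌋₊ : ℝ) ≠ 0 := by
      have := (Nat.one_le_floor_iff (t : ℝ)).2 ht'
      positivity
    rw [div_mul_div_cancel₀ hpos]
    have : ((⌊(t : ℝ)⌋₊ : ℕ) : ℝ≥0) ≤ t := by
      rw [← NNReal.coe_le_coe, NNReal.coe_natCast]
      exact Nat.floor_le t.2
    exact div_le_div_of_nonneg_right (hf this) t.2
  · filter_upwards [eventually_ge_atTop 1] with t ht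
    have ht' : (0 : ℝ) < t := lt_of_lt_of_le one_pos (by exact_mod_cast ht)
    have hpos : (⌈(t : ℝ)⌉₊ : ℝ) ≠ 0 := by
      have := Nat.ceil_pos.2 ht'
      positivity
    rw [div_mul_div_cancel₀ hpos]
    have : t ≤ ((⌈(t : ℝ)⌉₊ : ℕ) : ℝ≥0) := by
      rw [← NNReal.coe_le_coe, NNReal.coe_natCast]
      exact Nat.le_ceil _
    exact div_le_div_of_nonneg_right (hf this) t.2

lemma ae_tendsto_V_div {Ω : Type*} [MeasurableSpace Ω] {P : Measure Ω} [IsProbabilityMeasure P]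
    {lam : ℝ≥0} {n : ℕ} {N : ℕ → ℝ≥0 → Ω → ℕ}
    (hN : ∀ i ∈ Finset.Icc 1 n, IsPoissonProcess (N i) lam P)
    (hindep : iIndepFun (fun (i : Finset.Icc 1 n) ω t => N i t ω) P) :
    ∀ᵐ ω ∂P, Tendsto (fun t : ℝ≥0 => V N n t ω / (t : ℝ)) atTop (𝓝 ((lam : ℝ) ^ n)) := by
  have hVm := measurable_V fun i hi => (hN i hi).measurable
  have hJ := hasJointExponent_V hN hindep
  let D : ℕ → Ω → ℝ := fun i ω => V N n ((i + 1 : ℕ) : ℝ≥0) ω - V N n (i : ℝ≥0) ω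
  have hind : iIndepFun D P :=
    (hasIndepIncrements_V hN hindep).nat (t := fun i : ℕ => (i : ℝ≥0)) Nat.mono_cast
  have hle : ∀ i : ℕ, (i : ℝ≥0) ≤ ((i + 1 : ℕ) : ℝ≥0) := fun i => Nat.mono_cast (Nat.le_succ i)
  have hident : ∀ i, IdentDistrib (D i) (D 0) P P := fun i =>
    ⟨((hVm _).sub (hVm _)).aemeasurable, ((hVm _).sub (hVm _)).aemeasurable,
      map_increment_eq_of_hasJointExponent hJ hJ hVm hVm (hle i) (hle 0) (by push_cast; ring)⟩
  obtain ⟨hL, hmean, -⟩ := moments_increment_V hN hindep (hle 0)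
  have hmean' : ∫ ω, D 0 ω ∂P = (lam : ℝ) ^ n := by
    refine hmean.trans ?_
    simp
  have hslln := strong_law_ae_real D (hL.integrable one_le_two)
    (fun i j hij => hind.indepFun hij) hident
  rw [hmean'] at hslln
  filter_upwards [hslln, ae_V_zero hN, ae_path_V hN] with ω h1 h0 hpath
  refine tendsto_div_of_monotone_of_nat hpath.1 (h1.congr fun k => ?_)
  rw [Finset.sum_range_sub (fun i : ℕ => V N n (i : ℝ≥0) ω), Nat.cast_zero, h0, sub_zero]

end LawOfLargeNumbers

/-! ### Lévy measures of the iterated process -/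

section LevyTriplets

variable {Ω : Type*} [MeasurableSpace Ω] {P : Measure Ω} [IsProbabilityMeasure P]
  {lam : ℝ≥0} {N : ℕ → ℝ≥0 → Ω → ℕ}

/-- This covers both `P` (with `θ = 0`) and the tilted measures. -/
lemma hasLevyMeasure_V {m : ℕ} (hN : ∀ i ∈ Finset.Icc 1 (m + 1), IsPoissonProcess (N i) lam P)
    (hindep : iIndepFun (fun (i : Finset.Icc 1 (m + 1)) ω t => N i t ω) P) {T : ℝ≥0∞} {θ : ℝ}
    {Q : Measure Ω} [IsProbabilityMeasure Q] (hQ : Q ≪ P)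
    (hJ : HasJointExponent T (V N (m + 1)) Q
      fun z => ellC lam (m + 1) (z + θ) - ellC lam (m + 1) θ) :
    HasLevyMeasure T (V N (m + 1)) Q
      (atomicMeasure fun k => (lam : ℝ) * Real.exp (k * θ) * pmf P N m k) := by
  have hc := forall_castSucc hN
  obtain ⟨κ, hκ, hVκ⟩ := exists_nat_V_one fun i hi => (hc i hi).measurable
  have hpmf : ∀ k, pmf P N m k = P.real {ω | κ ω = k} := fun k => by
    simp only [pmf, hVκ, Nat.cast_inj]
  simp_rw [hpmf]
  have h0 := hQ.ae_le (ae_V_zero hN)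
  have hexp := (hasJointExponent_V hc (iIndepFun_castSucc hindep)).hasExponent (ae_V_zero hc) 1
    le_top
  refine hasLevyMeasure_atomic hκ (φ := ellC lam m) (fun z => ?_)
    (hJ.isLevyProcess (fun t _ => measurable_V (fun i hi => (hN i hi).measurable) t) h0
      (hQ.ae_le (ae_path_V hN))) ?_
  · simpa only [hVκ, Complex.ofReal_natCast, NNReal.coe_one, Complex.ofReal_one, one_mul]
      using hexp z
  · have h := hJ.hasExponent h0
    simpa only [ellC, sub_sub_sub_cancel_right] using h

end LevyTriplets

end MIPP

theorem proposition2p1 {Ω : Type*} [mΩ : MeasurableSpace Ω] (P : Measure Ω)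
    [IsProbabilityMeasure P] (lam : ℝ≥0) (hlam : 0 < lam) (n : ℕ) (hn : 1 ≤ n)
    (N : ℕ → ℝ≥0 → Ω → ℕ)
    (hN : ∀ i ∈ Finset.Icc 1 n, MIPP.IsPoissonProcess (N i) lam P)
    (hindep : iIndepFun (fun (i : Finset.Icc 1 n) ω t => N i t ω) P)
    (ℱ : Filtration ℝ≥0 mΩ)
    (hℱ : ℱ = MIPP.mippFiltration N n fun i hi => (hN i hi).measurable) :
    -- (a) mean and compensated martingale
    (∀ t : ℝ≥0, Integrable (MIPP.V N n t) P ∧ ∫ ω, MIPP.V N n t ω ∂P = (lam : ℝ) ^ n * t) ∧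
    Martingale (MIPP.M N lam n) ℱ P ∧
    -- (b) `ℓ_n` is the exponent of `V⁽ⁿ⁾`, the exponential martingale, and the tilted measures
    MIPP.HasExponent ∞ (MIPP.V N n) P (MIPP.ellC lam n) ∧
    (∀ θ : ℝ, Martingale
      (fun (t : ℝ≥0) ω => Real.exp (θ * MIPP.V N n t ω - (t : ℝ) * MIPP.ell lam n θ)) ℱ P) ∧
    (∀ (θ : ℝ) (T : ℝ≥0),
      IsProbabilityMeasure (MIPP.tilt P N lam n θ T) ∧
      MIPP.tilt P N lam n θ T ≪ P ∧ P ≪ MIPP.tilt P N lam n θ T ∧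
      (∀ s ≤ T, ∀ A : Set Ω, MeasurableSet[ℱ s] A →
        MIPP.tilt P N lam n θ T A = MIPP.tilt P N lam n θ s A) ∧
      MIPP.HasExponent T (MIPP.V N n) (MIPP.tilt P N lam n θ T)
        (fun z => MIPP.ellC lam n (z + (θ : ℂ)) - MIPP.ellC lam n (θ : ℂ))) ∧
    -- (c) the quadratic martingale
    Martingale (fun (t : ℝ≥0) ω => MIPP.M N lam n t ω ^ 2 -
      MIPP.geomRatio lam n * (lam : ℝ) ^ n * (t : ℝ)) ℱ P ∧
    -- (d) compound Poisson representation and Lévy measures under `P` and `P^θ`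
    (∃ Y : ℕ → Ω → ℝ≥0, MIPP.IsJumpSequence Y N (n - 1) P) ∧
    (∀ Y : ℕ → Ω → ℝ≥0, MIPP.IsJumpSequence Y N (n - 1) P →
      IdentDistrib (fun ω t => MIPP.mipp N n t ω)
        (fun ω (t : ℝ≥0) => ∑ i ∈ Finset.range (N 1 t ω), Y i ω) P P) ∧
    MIPP.HasLevyMeasure ∞ (MIPP.V N n) P
      (MIPP.atomicMeasure fun k => (lam : ℝ) * MIPP.pmf P N (n - 1) k) ∧
    (∀ (θ : ℝ) (T : ℝ≥0), MIPP.HasLevyMeasure T (MIPP.V N n) (MIPP.tilt P N lam n θ T)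
      (MIPP.atomicMeasure fun k =>
        (lam : ℝ) * Real.exp (k * θ) * MIPP.pmf P N (n - 1) k)) ∧
    -- (e) strong law of large numbers
    (∀ᵐ ω ∂P, Tendsto (fun t : ℝ≥0 => MIPP.V N n t ω / (t : ℝ)) atTop (𝓝 ((lam : ℝ) ^ n))) := by
  subst hℱ
  obtain ⟨m, rfl⟩ : ∃ m, n = m + 1 := ⟨n - 1, by omega⟩
  have hJ := MIPP.hasJointExponent_V hN hindep
  have h0 := MIPP.ae_V_zero hN
  refine ⟨fun t => ?_, ?_, hJ.hasExponent h0, fun θ => MIPP.martingale_exp_V hN hindep θ,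
    fun θ T => ⟨MIPP.isProbabilityMeasure_tilt hN hindep θ T, MIPP.tilt_absolutelyContinuous θ T,
      MIPP.absolutelyContinuous_tilt (fun i hi => (hN i hi).measurable) θ T,
      fun s hs A hA => MIPP.tilt_apply_eq_of_le hN hindep θ hs hA,
      (MIPP.hasJointExponent_tilt hN hindep θ T).hasExponent
        ((MIPP.tilt_absolutelyContinuous θ T).ae_le h0)⟩, ?_,
    ⟨_, MIPP.isJumpSequence_increments hN hindep⟩,
    fun Y hY => MIPP.identDistrib_mipp_compound hN hindep hY, ?_, fun θ T => ?_,
    MIPP.ae_tendsto_V_div hN hindep⟩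
  · obtain ⟨h1, h2⟩ := MIPP.moments_V hN hindep t
    exact ⟨h1.integrable one_le_two, h2⟩
  · exact MIPP.martingale_of_indep_increments (MIPP.stronglyAdapted_M _)
      (fun t => (MIPP.memLp_M hN hindep t).integrable one_le_two)
      (fun _ _ hst => MIPP.indep_increment_M hN hindep hst)
      fun _ _ hst => MIPP.integral_increment_M hN hindep hst
  · exact MIPP.martingale_sq_of_indep_increments (MIPP.stronglyAdapted_M _)
      (MIPP.memLp_M hN hindep) (fun _ _ hst => MIPP.indep_increment_M hN hindep hst)
      (fun _ _ hst => MIPP.integral_increment_M hN hindep hst)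
      fun _ _ hst => MIPP.integral_increment_M_sq hN hindep hst
  · have h := MIPP.hasLevyMeasure_V (θ := 0) hN hindep Measure.AbsolutelyContinuous.rfl
      (by simpa [MIPP.ellC_zero] using hJ)
    simpa using h
  · have := MIPP.isProbabilityMeasure_tilt hN hindep θ T
    exact MIPP.hasLevyMeasure_V hN hindep (MIPP.tilt_absolutelyContinuous θ T)
      (MIPP.hasJointExponent_tilt hN hindep θ T)
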